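/- Let $\alpha,\alpha',\beta,\beta',\gamma,\rho,c\in\mathbb C$ and $x>0$. For $f:(0,\infty)\to\mathbb C$ the left-sided Marichev–Saigo–Maeda fractional integral is $$\left(I_{0,+}^{\alpha,\alpha',\beta,\beta',\gamma}f\right)(x)=\frac{x^{-\alpha}}{\Gamma(\gamma)}\int_0^x (x-t)^{\gamma-1}t^{-\alpha'}F_3\!\left(\alpha,\alpha',\beta,\beta';\gamma;1-\tfrac tx,1-\tfrac xt\right)f(t)\,dt ,$$ where $F_3(a,a',b,b';c;u,v)$ is Appell's function $\sum_{m,n\ge 0}\frac{(a)_m(a')_n(b)_m(b')_n}{(c)_{m+n}\,m!\,n!}u^mv^n$, continued analytically along the segment from the origin to $(u,v)$ (principal value). The generalized Wright function is $${}_p\psi_q\!\left[\begin{matrix}(a_i,\alpha_i)_{1,p}\\(b_j,\beta_j)_{1,q}\end{matrix}\Big|z\right]=\sum_{k=0}^\infty\frac{\prod_{i=1}^p\Gamma(a_i+\alpha_ik)}{\prod_{j=1}^q\Gamma(b_j+\beta_jk)}\,\frac{z^k}{k!}.$$ Suppose that $\operatorname{Re}\gamma>0$ and $$\operatorname{Re}(\rho+1)>\max\{0,\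 \operatorname{Re}(\alpha+\alpha'+\beta-\gamma),\ \operatorname{Re}(\alpha'-\beta')\}.$$ Then the integrals and series below converge absolutely, and $$\left(I_{0,+}^{\alpha,\alpha',\beta,\beta',\gamma}\,t^{\rho-1}\sin(ct)\right)(x)=\frac{c\sqrt\pi}{2}\,x^{\rho-\alpha-\alpha'+\gamma}\;{}_3\psi_4\!\left[\begin{matrix}(\rho+1,2),(\rho+1+\gamma-\alpha-\alpha'-\beta,2),(\rho+1+\beta'-\alpha',2)\\(\rho+1+\beta',2),(\rho+1+\gamma-\alpha-\alpha',2),(\rho+1+\gamma-\alpha'-\beta,2),(\tfrac32,1)\end{matrix}\Big|-\frac{c^2x^2}{4}\right],$$ $$\left(I_{0,+}^{\alpha,\alpha',\beta,\beta',\gamma}\,t^{\rho-1}\sinh(ct)\right)(x)=\frac{c\sqrt\pi}{2}\,x^{\rho-\alpha-\alpha'+\gamma}\;{}_3\psi_4\!\left[\begin{matrix}(\rho+1,2),(\rho+1+\gamma-\alpha-\alpha'-\beta,2),(\rho+1+\beta'-\alpha',2)\\(\rho+1+\beta',2),(\rho+1+\gamma-\alpha-\alpha',2),(\rho+1+\gamma-\alpha'-\beta,2),(\tfrac32,1)\end{matrix}\Big|\frac{c^2x^2}{4}\right].$$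 -/

import Mathlib

open Filter Topology MeasureTheory

noncomputable section

/-- The Appell double series
`∑_{m,n} (a)_m (a')_n (b)_m (b')_n / ((c)_{m+n} m! n!) u^m v^n` defining `F₃` near the origin. -/
def appellF3Series (a a' b b' c u v : ℂ) : ℂ :=
  ∑' i : ℕ × ℕ,
    (ascPochhammer ℂ i.1).eval a * (ascPochhammer ℂ i.2).eval a' *
      (ascPochhammer ℂ i.1).eval b * (ascPochhammer ℂ i.2).eval b' /
      ((ascPochhammer ℂ (i.1 + i.2)).eval c * (i.1.factorial : ℂ) * (i.2.factorial : ℂ)) *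
      u ^ i.1 * v ^ i.2

/-- `g` is a holomorphic continuation, to an open set `U ∋ 1` that is star-shaped about `0`, of
the restriction `l ↦ F₃(l u, l v)` of the Appell series to the complex line through `(u, v)`. -/
def IsAppellF3Continuation (a a' b b' c u v : ℂ) (U : Set ℂ) (g : ℂ → ℂ) : Prop :=
  IsOpen U ∧ StarConvex ℝ 0 U ∧ (1 : ℂ) ∈ U ∧ DifferentiableOn ℂ g U ∧
    ∀ᶠ l in 𝓝 (0 : ℂ), g l = appellF3Series a a' b b' c (l * u) (l * v)

open Classical in
/-- Appell's function `F₃(a, a', b, b'; c; u, v)`: the principal value, i.e. the analytic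
continuation of the Appell series from the origin along the straight segment to `(u, v)`
(with value `0` if there is no such continuation). In the bidisc `|u|, |v| < 1` it is the series.
The value does not depend on the continuation chosen, see `appellF3_eq`. -/
def appellF3 (a a' b b' c u v : ℂ) : ℂ :=
  if h : ∃ w : ℂ, ∃ U : Set ℂ, ∃ g : ℂ → ℂ,
      IsAppellF3Continuation a a' b b' c u v U g ∧ g 1 = w
  then h.choose else 0

theorem appellF3_eq {a a' b b' c u v : ℂ} {U : Set ℂ} {g : ℂ → ℂ}
    (hg : IsAppellF3Continuation a a' b b' c u v U g) :
    appellF3 a a' b b' c u v = g 1 := by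
  have h : ∃ w : ℂ, ∃ U : Set ℂ, ∃ g : ℂ → ℂ,
      IsAppellF3Continuation a a' b b' c u v U g ∧ g 1 = w := ⟨g 1, U, g, hg, rfl⟩
  have h1 : appellF3 a a' b b' c u v = h.choose := dif_pos h
  obtain ⟨V, k, hk, hk1⟩ := h.choose_spec
  rw [h1, ← hk1]
  obtain ⟨oU, sU, mU, dU, eU⟩ := hg
  obtain ⟨oV, sV, mV, dV, eV⟩ := hk
  have hs : StarConvex ℝ (0 : ℂ) (V ∩ U) := sV.inter sU
  have hne : (V ∩ U).Nonempty := ⟨1, mV, mU⟩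
  have h0 : (0 : ℂ) ∈ V ∩ U := hs.mem hne
  have hp : IsPreconnected (V ∩ U) := (hs.isPathConnected h0).isConnected.isPreconnected
  refine AnalyticOnNhd.eqOn_of_preconnected_of_eventuallyEq
    ((dV.mono Set.inter_subset_left).analyticOnNhd (oV.inter oU))
    ((dU.mono Set.inter_subset_right).analyticOnNhd (oV.inter oU)) hp h0 ?_ ⟨mV, mU⟩
  filter_upwards [eU, eV] with l h2 h3
  rw [h2, h3]

/-- The integrand `(x-t)^{γ-1} t^{-α'} F₃(α, α', β, β'; γ; 1 - t/x, 1 - x/t) f(t)`. -/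
def msmIntegrand (α α' β β' γ : ℂ) (f : ℝ → ℂ) (x t : ℝ) : ℂ :=
  ((x - t : ℝ) : ℂ) ^ (γ - 1) * (t : ℂ) ^ (-α') *
    appellF3 α α' β β' γ ((1 - t / x : ℝ) : ℂ) ((1 - x / t : ℝ) : ℂ) * f t

/-- The left-sided Marichev–Saigo–Maeda fractional integral `(I_{0,+}^{α,α',β,β',γ} f)(x)`. -/
def msmLeft (α α' β β' γ : ℂ) (f : ℝ → ℂ) (x : ℝ) : ℂ :=
  (x : ℂ) ^ (-α) / Complex.Gamma γ *
    ∫ t in Set.Ioo 0 x, msmIntegrand α α' β β' γ f x t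

/-- The `k`-th term of the generalized Wright series; the entries of `a` and `b` are the pairs
`(a_i, α_i)` and `(b_j, β_j)`. The reciprocal `1 / Γ` of a lower factor vanishes at the poles
of `Γ`, as it should, because `Complex.Gamma` is `0` there. -/
def wrightTerm {p q : ℕ} (a : Fin p → ℂ × ℝ) (b : Fin q → ℂ × ℝ) (z : ℂ) (k : ℕ) : ℂ :=
  (∏ i, Complex.Gamma ((a i).1 + ((a i).2 : ℂ) * k)) /
    (∏ j, Complex.Gamma ((b j).1 + ((b j).2 : ℂ) * k)) * (z ^ k / (k.factorial : ℂ))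

/-- The generalized Wright function `ₚψ_q[(a_i, α_i); (b_j, β_j) | z]`. -/
def wrightPsi {p q : ℕ} (a : Fin p → ℂ × ℝ) (b : Fin q → ℂ × ℝ) (z : ℂ) : ℂ :=
  ∑' k : ℕ, wrightTerm a b z k

/-- Upper parameters `(r, 2), (r+γ-α-α'-β, 2), (r+β'-α', 2)`. -/
def upperParams (α α' β β' γ r : ℂ) : Fin 3 → ℂ × ℝ :=
  ![(r, 2), (r + γ - α - α' - β, 2), (r + β' - α', 2)]

/-- Lower parameters `(r+β', 2), (r+γ-α-α', 2), (r+γ-α'-β, 2), (3/2, 1)`. -/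
def lowerParams (α α' β β' γ r : ℂ) : Fin 4 → ℂ × ℝ :=
  ![(r + β', 2), (r + γ - α - α', 2), (r + γ - α' - β, 2), (3 / 2, 1)]

end

/-!
In the variable `s = t / x` the kernel involves `F₃(α, α', β, β'; γ; u, v)` at `u = 1 - s` and
`v = 1 - 1 / s`, and these satisfy `v / (v - 1) = u`. Pfaff's transformation of the inner `₂F₁` in
the second variable (`pfaff_transformation`) therefore provides the continuation of the Appell
series along the segment from the origin to `(u, v)` (`isAppellF3Continuation_pfaff`), and turns the
kernel into `s^α'` times a double power series `H` on the diagonal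
(`appellF3_eq_cpow_mul_pfaffSeries`)
`H(u) = ∑_{m,n} (α)_m (β)_m (α')_n (γ - β' + m)_n / ((γ)_{m+n} m! n!) u^{m+n}`.

The moments `∫₀¹ s^(r-1) (1-s)^(γ-1) H(1-s) ds` are quotients of Gamma functions (`moment`). If
`Re α' > 0`, sharp bounds for Pochhammer symbols (`norm_poch_add_le`, `le_norm_poch`) show that the
double series may be integrated term by term in the whole range of the parameters; the Beta integral
and two applications of Gauss's theorem (`hasSum_gaussTerm`) then sum it (`moment_of_re_pos`).
For other `α'` termwise integration can fail, because the convergence of the integral depends on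
cancellation in the coefficients of `H`. However, the contiguous relation
`H(α', β'; γ) = (1 - u) H(α' + 1, β'; γ) + (β' / γ) u H(α' + 1, β' + 1; γ + 1)`
(`pfaffSeries_contiguous`) preserves all the conditions for convergence, and the Gamma quotients
satisfy the same recurrence (`momentValue_contiguous`), so induction reduces to `Re α' > 0`.

Finally, `sin z / z` and `sinh z / z` are the entire series `∑ w^k / (2k+1)!` at `w = ∓z²`. As the
kernel times `s^ρ` is integrable, dominated convergence permits integrating this series termwise
(`moment_sineSeries`). By the duplication formula the integrated terms are those of the Wright
series, whose convergence is part of the conclusion.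
-/

/-! ### Pochhammer symbols -/

/-- The Pochhammer symbol `(a)_n = a (a + 1) ⋯ (a + n - 1)`. -/
noncomputable def poch (a : ℂ) (n : ℕ) : ℂ := (ascPochhammer ℂ n).eval a

@[simp] theorem poch_zero (a : ℂ) : poch a 0 = 1 := by simp [poch]

theorem poch_succ (a : ℂ) (n : ℕ) : poch a (n + 1) = poch a n * (a + n) := by
  simp [poch, ascPochhammer_succ_eval]

theorem poch_succ_left (a : ℂ) (n : ℕ) : poch a (n + 1) = a * poch (a + 1) n := by
  induction n with
  | zero => simp [poch_succ]
  | succ n ih =>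
    rw [poch_succ, ih, poch_succ]
    push_cast
    ring

theorem poch_add (a : ℂ) (m n : ℕ) : poch a (m + n) = poch a m * poch (a + m) n := by
  induction n with
  | zero => simp
  | succ n ih =>
    rw [← add_assoc, poch_succ, ih, poch_succ]
    push_cast
    ring

theorem add_natCast_ne_zero_of_re_pos {c : ℂ} (hc : 0 < c.re) (n : ℕ) : c + n ≠ 0 := by
  intro h
  have := congrArg Complex.re h
  simp at this
  have : (0 : ℝ) ≤ n := by positivity
  linarith

theorem poch_ne_zero_of_re_pos {c : ℂ} (hc : 0 < c.re) (n : ℕ) : poch c n ≠ 0 := by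
  induction n with
  | zero => simp
  | succ n ih => rw [poch_succ]; exact mul_ne_zero ih (add_natCast_ne_zero_of_re_pos hc n)

theorem poch_eq_prod (a : ℂ) (n : ℕ) : poch a n = ∏ j ∈ Finset.range n, (a + j) := by
  induction n with
  | zero => simp
  | succ n ih => rw [poch_succ, ih, Finset.prod_range_succ]

/-- `Γ(a + n) = (a)_n Γ(a)` in a form which holds at the poles of `Γ` as well. -/
theorem inv_Gamma_eq_poch_mul (a : ℂ) (n : ℕ) :
    (Complex.Gamma a)⁻¹ = poch a n * (Complex.Gamma (a + n))⁻¹ := by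
  induction n with
  | zero => simp
  | succ n ih =>
    rw [ih, Complex.one_div_Gamma_eq_self_mul_one_div_Gamma_add_one, poch_succ]
    push_cast
    ring_nf

theorem Gamma_add_natCast_of_re_pos {c : ℂ} (hc : 0 < c.re) (n : ℕ) :
    Complex.Gamma (c + n) = poch c n * Complex.Gamma c := by
  have h1 : Complex.Gamma c ≠ 0 := Complex.Gamma_ne_zero_of_re_pos hc
  have h2 : Complex.Gamma (c + n) ≠ 0 := Complex.Gamma_ne_zero_of_re_pos (by simp; positivity)
  have := inv_Gamma_eq_poch_mul c n
  field_simp at this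
  rw [mul_comm]
  exact this

/-- The factor `d + j` of a Pochhammer symbol, compared with the corresponding factor of
`(j + 1)! (j + 2)^(Re d - 1)`. -/
theorem norm_add_natCast_le (d : ℂ) : ∃ K : ℝ, 0 ≤ K ∧ ∀ j : ℕ,
    ‖d + j‖ ≤ (j + 1) * (((j : ℝ) + 2) / (j + 1)) ^ (d.re - 1) *
      Real.exp (K * (1 / (j + 1) - 1 / (j + 2))) := by
  -- with `y = 1 / (j + 1)` the claim compares `|1 + e y|` and `(1 + y)^(Re e)` up to `exp O(y²)`,
  -- and `y²` is at most twice the telescoping difference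
  set e : ℂ := d - 1 with he
  refine ⟨2 * (‖e‖ ^ 2 / 2 + |e.re|), by positivity, fun j => ?_⟩
  set y : ℝ := 1 / (j + 1) with hy
  have hj : (0 : ℝ) ≤ j := by positivity
  have hy0 : 0 < y := by positivity
  have hj1 : (j : ℝ) + 1 = 1 / y := by rw [hy]; field_simp
  have hq : ((j : ℝ) + 2) / (j + 1) = 1 + y := by rw [hy]; field_simp; ring
  have hdj : d + j = ((1 / y : ℝ) : ℂ) * (1 + e * y) := by
    have : ((1 / y : ℝ) : ℂ) = j + 1 := by rw [← hj1]; push_cast; rfl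
    have hy2 : (y : ℂ) = 1 / (j + 1) := by rw [hy]; push_cast; rfl
    have hne : (j : ℂ) + 1 ≠ 0 := by exact_mod_cast Nat.succ_ne_zero j
    rw [this, hy2, he]
    field_simp
    ring
  have hsq : ‖1 + e * y‖ ^ 2 ≤ Real.exp (e.re * y + ‖e‖ ^ 2 / 2 * y ^ 2) ^ 2 := by
    have h1 : ‖1 + e * y‖ ^ 2 = 2 * (e.re * y + ‖e‖ ^ 2 / 2 * y ^ 2) + 1 := by
      rw [← Complex.normSq_eq_norm_sq, ← Complex.normSq_eq_norm_sq, Complex.normSq_apply,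
        Complex.normSq_apply]
      simp
      ring
    rw [h1, ← Real.exp_nat_mul]
    exact_mod_cast Real.add_one_le_exp _
  have hle : ‖1 + e * y‖ ≤ Real.exp (e.re * y + ‖e‖ ^ 2 / 2 * y ^ 2) :=
    le_of_sq_le_sq hsq (Real.exp_pos _).le
  have hlog1 : Real.log (1 + y) ≤ y := by
    have := Real.log_le_sub_one_of_pos (show 0 < 1 + y by positivity); linarith
  have hlog2 : y - y ^ 2 ≤ Real.log (1 + y) := by
    have := Real.one_sub_inv_le_log_of_pos (show 0 < 1 + y by positivity)
    refine le_trans ?_ this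
    have : 1 - (1 + y)⁻¹ - (y - y ^ 2) = y ^ 3 / (1 + y) := by field_simp; ring
    have h3 : 0 ≤ y ^ 3 / (1 + y) := by positivity
    linarith
  have hre : e.re * y ≤ e.re * Real.log (1 + y) + |e.re| * y ^ 2 := by
    have h1 : e.re * (y - Real.log (1 + y)) ≤ |e.re| * y ^ 2 := by
      refine (le_abs_self _).trans ?_
      rw [abs_mul]
      refine mul_le_mul_of_nonneg_left ?_ (abs_nonneg _)
      rw [abs_of_nonneg (by linarith)]
      linarith
    linarith
  have hK : y ^ 2 ≤ 2 * (1 / (j + 1) - 1 / (j + 2)) := by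
    have : 2 * (1 / ((j : ℝ) + 1) - 1 / (j + 2)) - y ^ 2 = j / ((j + 1) ^ 2 * (j + 2)) := by
      rw [hy]; field_simp; ring
    have h3 : 0 ≤ (j : ℝ) / ((j + 1) ^ 2 * (j + 2)) := by positivity
    linarith
  rw [hdj, norm_mul, hq, Complex.norm_real, Real.norm_of_nonneg (by positivity), hj1, mul_assoc]
  refine mul_le_mul_of_nonneg_left ?_ (by positivity)
  refine hle.trans ?_
  rw [Real.rpow_def_of_pos (by positivity), ← Real.exp_add]
  refine Real.exp_le_exp.2 ?_
  have her : d.re - 1 = e.re := by simp [he]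
  rw [her]
  have h4 : (‖e‖ ^ 2 / 2 + |e.re|) * y ^ 2 ≤
      (‖e‖ ^ 2 / 2 + |e.re|) * (2 * (1 / (j + 1) - 1 / (j + 2))) :=
    mul_le_mul_of_nonneg_left hK (by positivity)
  rw [← hy] at h4
  linarith

/-- Upper bound for `(d + m)_n`, uniform in `m` and `n`, with the exact power of the growth. -/
theorem norm_poch_add_le (d : ℂ) : ∃ C : ℝ, 0 < C ∧ ∀ m n : ℕ,
    ‖poch (d + m) n‖ ≤ C * (((m + n).factorial : ℝ) / m.factorial) *
      (((m + n : ℕ) + 1 : ℝ) / (m + 1)) ^ (d.re - 1) := by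
  obtain ⟨K, hK, h⟩ := norm_add_natCast_le d
  refine ⟨Real.exp K, Real.exp_pos _, fun m n => ?_⟩
  have key : ‖poch (d + m) n‖ ≤ (((m + n).factorial : ℝ) / m.factorial) *
      (((m + n : ℕ) + 1 : ℝ) / (m + 1)) ^ (d.re - 1) *
        Real.exp (K * (1 / (m + 1) - 1 / ((m + n : ℕ) + 1))) := by
    induction n with
    | zero =>
      have h1 : (m.factorial : ℝ) ≠ 0 := by positivity
      have h2 : (m : ℝ) + 1 ≠ 0 := by positivity
      simp [h1, h2]
    | succ n ih =>
      have h2 := h (m + n)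
      rw [poch_succ, norm_mul]
      have h3 : d + (m : ℂ) + n = d + ((m + n : ℕ) : ℂ) := by push_cast; ring
      rw [h3]
      refine (mul_le_mul ih h2 (norm_nonneg _) (by positivity)).trans (le_of_eq ?_)
      set N : ℝ := ((m + n : ℕ) : ℝ) with hN
      have hN0 : 0 ≤ N := by positivity
      have e1 : (((m + (n + 1)).factorial : ℕ) : ℝ) = (N + 1) * ((m + n).factorial : ℝ) := by
        rw [← add_assoc, Nat.factorial_succ]; push_cast [hN]; ring
      have e2 : ((m + (n + 1) : ℕ) : ℝ) + 1 = N + 2 := by push_cast [hN]; ring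
      have e3 : ((N + 2) / (m + 1)) ^ (d.re - 1) =
          ((N + 1) / (m + 1)) ^ (d.re - 1) * ((N + 2) / (N + 1)) ^ (d.re - 1) := by
        rw [← Real.mul_rpow (by positivity) (by positivity)]
        congr 1
        field_simp
      have e4 : Real.exp (K * (1 / (m + 1) - 1 / (N + 2))) =
          Real.exp (K * (1 / (m + 1) - 1 / (N + 1))) *
            Real.exp (K * (1 / (N + 1) - 1 / (N + 2))) := by
        rw [← Real.exp_add]; ring_nf
      rw [e1, e2, e3, e4]
      ring
  refine key.trans ?_
  have h5 : Real.exp (K * (1 / (m + 1) - 1 / ((m + n : ℕ) + 1))) ≤ Real.exp K := by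
    refine Real.exp_le_exp.2 ?_
    have h6 : (1 : ℝ) / (m + 1) ≤ 1 := by
      rw [div_le_one (by positivity)]; linarith [(Nat.cast_nonneg m : (0 : ℝ) ≤ m)]
    have h7 : (0 : ℝ) ≤ 1 / ((m + n : ℕ) + 1) := by positivity
    nlinarith
  calc _ ≤ (((m + n).factorial : ℝ) / m.factorial) *
      (((m + n : ℕ) + 1 : ℝ) / (m + 1)) ^ (d.re - 1) * Real.exp K :=
        mul_le_mul_of_nonneg_left h5 (by positivity)
    _ = _ := by ring

theorem norm_poch_le (d : ℂ) : ∃ C : ℝ, 0 < C ∧ ∀ n : ℕ,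
    ‖poch d n‖ ≤ C * n.factorial * ((n : ℝ) + 1) ^ (d.re - 1) := by
  obtain ⟨C, hC, h⟩ := norm_poch_add_le d
  refine ⟨C, hC, fun n => ?_⟩
  simpa using h 0 n

theorem GammaSeq_eq_div_poch (c : ℂ) (n : ℕ) :
    Complex.GammaSeq c n = (n : ℂ) ^ c * n.factorial / poch c (n + 1) := by
  rw [Complex.GammaSeq, poch_eq_prod]

/-- Lower bound for `(c)_n`, matching `norm_poch_le`. -/
theorem le_norm_poch {c : ℂ} (hc : 0 < c.re) : ∃ C : ℝ, 0 < C ∧ ∀ n : ℕ,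
    n.factorial * ((n : ℝ) + 1) ^ (c.re - 1) ≤ C * ‖poch c n‖ := by
  -- `n^c n! / (c)_(n+1)` converges, hence is bounded; `n = 0, 1` are treated separately since the
  -- sequence carries `n^c` instead of `(n + 1)^c`
  obtain ⟨M, hM⟩ := (Complex.GammaSeq_tendsto_Gamma c).norm.bddAbove_range
  have hM' : ∀ n : ℕ, ‖Complex.GammaSeq c n‖ ≤ M := fun n => hM ⟨n, rfl⟩
  have hM0 : 0 ≤ M := (norm_nonneg _).trans (hM' 0)
  set D : ℝ := max (2 * 3 ^ |c.re - 1| * M) (max 1 (2 ^ (c.re - 1) / ‖c‖)) with hD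
  have hc0 : c ≠ 0 := by rintro rfl; simp at hc
  have hcn : 0 < ‖c‖ := norm_pos_iff.2 hc0
  refine ⟨D, lt_of_lt_of_le one_pos ((le_max_left _ _).trans (le_max_right _ _)), fun n => ?_⟩
  match n with
  | 0 =>
    simp
    exact (le_max_left _ _).trans (le_max_right _ _)
  | 1 =>
    have : (2 : ℝ) ^ (c.re - 1) / ‖c‖ ≤ D := (le_max_right _ _).trans (le_max_right _ _)
    rw [div_le_iff₀ hcn] at this
    simp [poch_succ]
    norm_num
    exact this
  | n + 2 =>
    have h1 := hM' (n + 1)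
    have hp := norm_pos_iff.2 (poch_ne_zero_of_re_pos hc (n + 2))
    have hn1 : (0 : ℝ) < ((n + 1 : ℕ) : ℝ) := by positivity
    rw [GammaSeq_eq_div_poch, norm_div, norm_mul, div_le_iff₀ hp, Complex.norm_natCast,
      ← Complex.ofReal_natCast, Complex.norm_cpow_eq_rpow_re_of_pos hn1] at h1
    have hD1 : 2 * 3 ^ |c.re - 1| * M ≤ D := le_max_left _ _
    refine le_trans ?_ (mul_le_mul_of_nonneg_right hD1 hp.le)
    have h2 : (((n + 2 : ℕ) : ℝ) + 1) ^ (c.re - 1) ≤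
        3 ^ |c.re - 1| * ((n + 1 : ℕ) : ℝ) ^ (c.re - 1) := by
      have e : (((n + 2 : ℕ) : ℝ) + 1) =
          ((((n + 2 : ℕ) : ℝ) + 1) / ((n + 1 : ℕ) : ℝ)) * ((n + 1 : ℕ) : ℝ) := by field_simp
      rw [e, Real.mul_rpow (by positivity) (by positivity)]
      refine mul_le_mul_of_nonneg_right ?_ (by positivity)
      have hq1 : 1 ≤ (((n + 2 : ℕ) : ℝ) + 1) / ((n + 1 : ℕ) : ℝ) := by
        rw [le_div_iff₀ hn1]; push_cast; linarith
      have hq3 : (((n + 2 : ℕ) : ℝ) + 1) / ((n + 1 : ℕ) : ℝ) ≤ 3 := by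
        rw [div_le_iff₀ hn1]; push_cast; linarith [(Nat.cast_nonneg n : (0 : ℝ) ≤ n)]
      exact (Real.rpow_le_rpow_of_exponent_le hq1 (le_abs_self _)).trans
        (Real.rpow_le_rpow (by positivity) hq3 (abs_nonneg _))
    have h3 : (((n + 2).factorial : ℕ) : ℝ) ≤ 2 * ((n + 1 : ℕ) : ℝ) * ((n + 1).factorial : ℝ) := by
      rw [Nat.factorial_succ]
      push_cast
      refine mul_le_mul_of_nonneg_right ?_ (by positivity)
      linarith [(Nat.cast_nonneg n : (0 : ℝ) ≤ n)]
    have h4 : ((n + 1 : ℕ) : ℝ) ^ c.re =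
        ((n + 1 : ℕ) : ℝ) * ((n + 1 : ℕ) : ℝ) ^ (c.re - 1) := by
      rw [← Real.rpow_one_add' hn1.le (by linarith)]; ring_nf
    calc _ ≤ (2 * ((n + 1 : ℕ) : ℝ) * ((n + 1).factorial : ℝ)) *
          (3 ^ |c.re - 1| * ((n + 1 : ℕ) : ℝ) ^ (c.re - 1)) :=
            mul_le_mul h3 h2 (by positivity) (by positivity)
      _ = 2 * 3 ^ |c.re - 1| * (((n + 1 : ℕ) : ℝ) ^ c.re * ((n + 1).factorial : ℝ)) := by
            rw [h4]; ring
      _ ≤ 2 * 3 ^ |c.re - 1| * (M * ‖poch c (n + 2)‖) :=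
            mul_le_mul_of_nonneg_left h1 (by positivity)
      _ = _ := by ring

/-- A finite form of the Chu–Vandermonde identity. -/
theorem sum_choose_mul_poch_div (b : ℂ) {d : ℂ} (hd : 0 < d.re) (N : ℕ) :
    ∑ n ∈ Finset.range (N + 1), (N.choose n : ℂ) * (-1) ^ n * (poch (d - b) n / poch d n) =
      poch b N / poch d N := by
  induction N generalizing d with
  | zero => simp
  | succ N ih =>
    have hd1 : 0 < (d + 1).re := by simp; linarith
    have hd0 : d ≠ 0 := by rintro rfl; simp at hd
    have hstep : ∀ n, poch (d - b) (n + 1) / poch d (n + 1) =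
        (d - b) / d * (poch (d + 1 - b) n / poch (d + 1) n) := by
      intro n
      rw [poch_succ_left, poch_succ_left, mul_div_mul_comm]
      ring_nf
    have h1 : ∑ n ∈ Finset.range (N + 2), ((N + 1).choose n : ℂ) * (-1) ^ n *
        (poch (d - b) n / poch d n) =
        ∑ n ∈ Finset.range (N + 1), (N.choose n : ℂ) * (-1) ^ n * (poch (d - b) n / poch d n) -
        (d - b) / d * ∑ n ∈ Finset.range (N + 1), (N.choose n : ℂ) * (-1) ^ n *
          (poch (d + 1 - b) n / poch (d + 1) n) := by
      rw [Finset.sum_range_succ']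
      simp only [Nat.choose_succ_succ, hstep]
      have h2 : ∑ n ∈ Finset.range (N + 1), (N.choose n : ℂ) * (-1) ^ n *
          (poch (d - b) n / poch d n) = ∑ n ∈ Finset.range (N + 1),
            (N.choose (n + 1) : ℂ) * (-1) ^ (n + 1) * (poch (d - b) (n + 1) / poch d (n + 1)) +
            1 := by
        have := Finset.sum_range_succ' (fun n => (N.choose n : ℂ) * (-1) ^ n *
          (poch (d - b) n / poch d n)) (N + 1)
        rw [Finset.sum_range_succ] at this
        simpa using this
      rw [h2, Finset.mul_sum]
      simp only [hstep, Nat.choose_zero_right, poch_zero]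
      have h3 : ∀ p q r : ℂ, p = q - r → p + 1 = q + 1 - r := by rintro p q r rfl; ring
      norm_num
      apply h3
      rw [← Finset.sum_sub_distrib]
      refine Finset.sum_congr rfl fun n _ => ?_
      ring
    rw [h1, ih hd, ih hd1]
    have hp : poch d N * (d + N) = d * poch (d + 1) N := by rw [← poch_succ, poch_succ_left]
    have n1 := poch_ne_zero_of_re_pos hd N
    have n2 := poch_ne_zero_of_re_pos hd1 N
    have n3 := add_natCast_ne_zero_of_re_pos hd N
    rw [poch_succ, poch_succ]
    have : poch (d + 1) N = poch d N * (d + N) / d := by rw [hp]; field_simp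
    rw [this]
    field_simp
    ring

/-! ### Gauss's summation theorem -/

/-- Growth of `1 / Γ(C + n)`, for arbitrary complex `C`. -/
theorem norm_inv_Gamma_add_natCast_le (C : ℂ) : ∃ K : ℝ, 0 < K ∧ ∀ n : ℕ,
    n.factorial * ‖(Complex.Gamma (C + n))⁻¹‖ ≤ K * ((n : ℝ) + 1) ^ (1 - C.re) := by
  obtain ⟨k, hk⟩ := exists_nat_gt (-C.re)
  induction k generalizing C with
  | zero =>
    have hC : 0 < C.re := by simpa using hk
    obtain ⟨K, hK, h⟩ := le_norm_poch hC
    have hG : 0 < ‖Complex.Gamma C‖ := norm_pos_iff.2 (Complex.Gamma_ne_zero_of_re_pos hC)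
    refine ⟨K / ‖Complex.Gamma C‖, by positivity, fun n => ?_⟩
    have hp := norm_pos_iff.2 (poch_ne_zero_of_re_pos hC n)
    have h1 := h n
    rw [Gamma_add_natCast_of_re_pos hC, norm_inv, norm_mul, show 1 - C.re = -(C.re - 1) by ring,
      Real.rpow_neg (by positivity)]
    have hpow : 0 < ((n : ℝ) + 1) ^ (C.re - 1) := by positivity
    field_simp
    linarith
  | succ k ih =>
    obtain ⟨K, hK, h⟩ := ih (C + 1) (by push_cast at hk; simp; linarith)
    refine ⟨(‖C‖ + 1) * K, by positivity, fun n => ?_⟩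
    have h1 := h n
    have h2 : ‖C + n‖ ≤ (‖C‖ + 1) * ((n : ℝ) + 1) := by
      have := norm_add_le C n
      rw [Complex.norm_natCast] at this
      nlinarith [norm_nonneg C, (Nat.cast_nonneg n : (0 : ℝ) ≤ n)]
    rw [Complex.one_div_Gamma_eq_self_mul_one_div_Gamma_add_one, norm_mul,
      show C + n + 1 = C + 1 + n by ring]
    have h3 : ((n : ℝ) + 1) ^ (1 - C.re) = ((n : ℝ) + 1) * ((n : ℝ) + 1) ^ (1 - (C + 1).re) := by
      rw [show 1 - C.re = 1 + (1 - (C + 1).re) by simp; ring,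
        Real.rpow_add (by positivity), Real.rpow_one]
    rw [h3]
    calc _ = ‖C + n‖ * (n.factorial * ‖(Complex.Gamma (C + 1 + n))⁻¹‖) := by ring
      _ ≤ ((‖C‖ + 1) * ((n : ℝ) + 1)) * (K * ((n : ℝ) + 1) ^ (1 - (C + 1).re)) :=
        mul_le_mul h2 h1 (by positivity) (by positivity)
      _ = _ := by ring

/-- The `n`-th term of Gauss's series `₂F₁(a, b; C; 1) / Γ(C)`. -/
noncomputable def gaussTerm (a b C : ℂ) (n : ℕ) : ℂ :=
  poch a n * poch b n / n.factorial * (Complex.Gamma (C + n))⁻¹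

theorem norm_gaussTerm_le (a b C : ℂ) : ∃ K : ℝ, 0 < K ∧ ∀ n : ℕ,
    ‖gaussTerm a b C n‖ ≤ K * ((n : ℝ) + 1) ^ (-1 - (C - a - b).re) := by
  obtain ⟨A, hA, ha⟩ := norm_poch_le a
  obtain ⟨B, hB, hb⟩ := norm_poch_le b
  obtain ⟨K, hK, hc⟩ := norm_inv_Gamma_add_natCast_le C
  refine ⟨A * B * K, by positivity, fun n => ?_⟩
  have hf : (0 : ℝ) < n.factorial := by positivity
  rw [gaussTerm, norm_mul, norm_div, norm_mul, Complex.norm_natCast]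
  have hc' : ‖(Complex.Gamma (C + n))⁻¹‖ ≤ K * ((n : ℝ) + 1) ^ (1 - C.re) / n.factorial := by
    rw [le_div_iff₀ hf, mul_comm]; exact hc n
  calc _ ≤ (A * n.factorial * ((n : ℝ) + 1) ^ (a.re - 1)) *
        (B * n.factorial * ((n : ℝ) + 1) ^ (b.re - 1)) / n.factorial *
        (K * ((n : ℝ) + 1) ^ (1 - C.re) / n.factorial) := by
          gcongr
          · exact ha n
          · exact hb n
    _ = A * B * K * (((n : ℝ) + 1) ^ (a.re - 1) * ((n : ℝ) + 1) ^ (b.re - 1) *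
          ((n : ℝ) + 1) ^ (1 - C.re)) := by field_simp
    _ = _ := by
      rw [← Real.rpow_add (by positivity), ← Real.rpow_add (by positivity)]
      congr 2
      simp
      ring

theorem summable_add_one_rpow {p : ℝ} (hp : p < -1) : Summable fun n : ℕ => ((n : ℝ) + 1) ^ p := by
  have := (summable_nat_add_iff 1).2 (Real.summable_nat_rpow.2 hp)
  simpa using this

theorem summable_gaussTerm {a b C : ℂ} (h : 0 < (C - a - b).re) : Summable (gaussTerm a b C) := by
  obtain ⟨K, hK, hb⟩ := norm_gaussTerm_le a b C
  exact Summable.of_norm_bounded ((summable_add_one_rpow (by linarith)).mul_left K) hb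

/-- The contiguous relation in the lower parameter; the difference of both sides telescopes. -/
theorem tsum_gaussTerm_contiguous {a b C : ℂ} (h : 0 < (C - a - b).re) :
    (C - a - b) * ∑' n, gaussTerm a b C n =
      (C - a) * (C - b) * ∑' n, gaussTerm a b (C + 1) n := by
  have h1 : 0 < (C + 1 - a - b).re := by
    simp only [Complex.sub_re, Complex.add_re, Complex.one_re] at h ⊢; linarith
  have s0 := (summable_gaussTerm h).hasSum.mul_left (C - a - b)
  have s1 := (summable_gaussTerm h1).hasSum.mul_left ((C - a) * (C - b))
  have hs := (s0.sub s1).tendsto_sum_nat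
  set u : ℕ → ℂ := fun n => -(n * gaussTerm a b C n) with hu
  have htel : ∀ n, (C - a - b) * gaussTerm a b C n - (C - a) * (C - b) * gaussTerm a b (C + 1) n =
      u (n + 1) - u n := by
    intro n
    have hf : (n.factorial : ℂ) ≠ 0 := by exact_mod_cast Nat.factorial_ne_zero n
    have hn : (n : ℂ) + 1 ≠ 0 := by exact_mod_cast Nat.succ_ne_zero n
    simp only [hu, gaussTerm, poch_succ, Nat.factorial_succ]
    rw [Complex.one_div_Gamma_eq_self_mul_one_div_Gamma_add_one (C + n)]
    push_cast
    rw [show C + 1 + n = C + n + 1 by ring, show C + (n + 1) = C + n + 1 by ring]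
    field_simp
    ring
  have hu0 : Tendsto u atTop (𝓝 0) := by
    obtain ⟨K, hK, hb⟩ := norm_gaussTerm_le a b C
    have hz : Tendsto (fun n : ℕ => K * ((n : ℝ) + 1) ^ (-(C - a - b).re)) atTop (𝓝 0) := by
      have := (tendsto_rpow_neg_atTop h).comp
        (tendsto_atTop_add_const_right _ (1 : ℝ) tendsto_natCast_atTop_atTop)
      simpa using this.const_mul K
    refine squeeze_zero_norm (fun n => ?_) hz
    rw [hu, norm_neg, norm_mul, Complex.norm_natCast]
    have e : ((n : ℝ) + 1) ^ (-(C - a - b).re) =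
        ((n : ℝ) + 1) * ((n : ℝ) + 1) ^ (-1 - (C - a - b).re) := by
      rw [show -(C - a - b).re = 1 + (-1 - (C - a - b).re) by ring,
        Real.rpow_add (by positivity), Real.rpow_one]
    rw [e]
    calc _ ≤ ((n : ℝ) + 1) * (K * ((n : ℝ) + 1) ^ (-1 - (C - a - b).re)) :=
          mul_le_mul (by linarith) (hb n) (norm_nonneg _) (by positivity)
      _ = _ := by ring
  have hl : Tendsto (fun N => ∑ n ∈ Finset.range N, ((C - a - b) * gaussTerm a b C n -
      (C - a) * (C - b) * gaussTerm a b (C + 1) n)) atTop (𝓝 0) := by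
    simp only [htel, Finset.sum_range_sub]
    simpa [hu] using hu0
  exact sub_eq_zero.1 (tendsto_nhds_unique hs hl)

theorem Gamma_add_natCast_succ_eq {z : ℂ} (hz : 0 < z.re) {k : ℕ} (hk : k ≠ 0) :
    Complex.Gamma (z + (k + 1 : ℕ)) =
      (k : ℂ) ^ z * k.factorial * Complex.Gamma z / Complex.GammaSeq z k := by
  have hk' : (k : ℂ) ≠ 0 := by exact_mod_cast hk
  have h1 : (k : ℂ) ^ z ≠ 0 := by simp [Complex.cpow_eq_zero_iff, hk']
  have hf : (k.factorial : ℂ) ≠ 0 := by exact_mod_cast Nat.factorial_ne_zero k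
  have hp := poch_ne_zero_of_re_pos hz (k + 1)
  rw [Gamma_add_natCast_of_re_pos hz, GammaSeq_eq_div_poch]
  field_simp

/-- By Euler's limit formula, since the powers of `k` in numerator and denominator agree. -/
theorem tendsto_Gamma_ratio {z₁ z₂ z₃ z₄ : ℂ} (h₁ : 0 < z₁.re) (h₂ : 0 < z₂.re) (h₃ : 0 < z₃.re)
    (h₄ : 0 < z₄.re) (h : z₁ + z₂ = z₃ + z₄) :
    Tendsto (fun k : ℕ => Complex.Gamma (z₁ + k) * Complex.Gamma (z₂ + k) /
      (Complex.Gamma (z₃ + k) * Complex.Gamma (z₄ + k))) atTop (𝓝 1) := by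
  rw [← tendsto_add_atTop_iff_nat 1]
  have g₁ := Complex.Gamma_ne_zero_of_re_pos h₁
  have g₂ := Complex.Gamma_ne_zero_of_re_pos h₂
  have g₃ := Complex.Gamma_ne_zero_of_re_pos h₃
  have g₄ := Complex.Gamma_ne_zero_of_re_pos h₄
  have hl : Tendsto (fun k : ℕ => (Complex.Gamma z₁ / Complex.GammaSeq z₁ k) *
      (Complex.Gamma z₂ / Complex.GammaSeq z₂ k) /
      ((Complex.Gamma z₃ / Complex.GammaSeq z₃ k) * (Complex.Gamma z₄ / Complex.GammaSeq z₄ k)))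
      atTop (𝓝 1) := by
    have key : ∀ z : ℂ, Complex.Gamma z ≠ 0 →
        Tendsto (fun k : ℕ => Complex.Gamma z / Complex.GammaSeq z k) atTop (𝓝 1) := by
      intro z hz
      have := (tendsto_const_nhds (x := Complex.Gamma z)).div (Complex.GammaSeq_tendsto_Gamma z) hz
      rw [div_self hz] at this
      exact this
    have := ((key _ g₁).mul (key _ g₂)).div ((key _ g₃).mul (key _ g₄)) (by simp)
    simp only [mul_one, div_one] at this
    exact this
  refine hl.congr' ?_
  filter_upwards [eventually_ne_atTop 0] with k hk
  have hk' : (k : ℂ) ≠ 0 := by exact_mod_cast hk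
  have hf : (k.factorial : ℂ) ≠ 0 := by exact_mod_cast Nat.factorial_ne_zero k
  rw [Gamma_add_natCast_succ_eq h₁ hk, Gamma_add_natCast_succ_eq h₂ hk,
    Gamma_add_natCast_succ_eq h₃ hk, Gamma_add_natCast_succ_eq h₄ hk]
  have hpow : (k : ℂ) ^ z₁ * (k : ℂ) ^ z₂ = (k : ℂ) ^ z₃ * (k : ℂ) ^ z₄ := by
    rw [← Complex.cpow_add _ _ hk', ← Complex.cpow_add _ _ hk', h]
  have n3 : (k : ℂ) ^ z₃ ≠ 0 := by simp [Complex.cpow_eq_zero_iff, hk']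
  have n4 : (k : ℂ) ^ z₄ ≠ 0 := by simp [Complex.cpow_eq_zero_iff, hk']
  have e : ∀ p₁ p₂ p₃ p₄ f x₁ x₂ x₃ x₄ : ℂ, f ≠ 0 → p₃ ≠ 0 → p₄ ≠ 0 → p₁ * p₂ = p₃ * p₄ →
      x₁ * x₂ / (x₃ * x₄) = (p₁ * f * x₁) * (p₂ * f * x₂) / ((p₃ * f * x₃) * (p₄ * f * x₄)) := by
    intro p₁ p₂ p₃ p₄ f x₁ x₂ x₃ x₄ hf h3 h4 hp
    rw [show (p₁ * f * x₁) * (p₂ * f * x₂) = (p₃ * p₄ * f * f) * (x₁ * x₂) by rw [← hp]; ring,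
      show (p₃ * f * x₃) * (p₄ * f * x₄) = (p₃ * p₄ * f * f) * (x₃ * x₄) by ring,
      mul_div_mul_left _ _ (by simp [hf, h3, h4])]
  simp only [mul_div_assoc]
  simpa only [mul_div_assoc] using e _ _ _ _ _ (Complex.Gamma z₁ / Complex.GammaSeq z₁ k)
    (Complex.Gamma z₂ / Complex.GammaSeq z₂ k) (Complex.Gamma z₃ / Complex.GammaSeq z₃ k)
    (Complex.Gamma z₄ / Complex.GammaSeq z₄ k) hf n3 n4 hpow

theorem norm_poch_mono {x : ℝ} (hx : 0 < x) {c : ℂ} (hc : x ≤ c.re) (n : ℕ) :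
    ‖poch x n‖ ≤ ‖poch c n‖ := by
  rw [poch_eq_prod, poch_eq_prod, norm_prod, norm_prod]
  refine Finset.prod_le_prod (fun _ _ => norm_nonneg _) fun j _ => ?_
  have h1 : ‖(x : ℂ) + j‖ = x + j := by
    rw [← Complex.ofReal_natCast, ← Complex.ofReal_add, Complex.norm_real,
      Real.norm_of_nonneg (by positivity)]
  rw [h1]
  refine le_trans ?_ (Complex.re_le_norm _)
  simpa using hc

/-- `₂F₁(a, b; C + k; 1) → 1` as `k → ∞`. -/
theorem tendsto_Gamma_mul_tsum_gaussTerm {a b C : ℂ} (h : 0 < (C - a - b).re) (hC : 0 < C.re) :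
    Tendsto (fun k : ℕ => Complex.Gamma (C + k) * ∑' n, gaussTerm a b (C + k) n) atTop (𝓝 1) := by
  have hre : ∀ k : ℕ, 0 < (C + k).re := fun k => by simp; positivity
  have heq : ∀ k n : ℕ, Complex.Gamma (C + k) * gaussTerm a b (C + k) n =
      poch a n * poch b n / n.factorial / poch (C + k) n := by
    intro k n
    have := Complex.Gamma_ne_zero_of_re_pos (hre k)
    rw [gaussTerm, Gamma_add_natCast_of_re_pos (hre k)]
    field_simp
  simp only [← tsum_mul_left, heq]
  have h1 : (1 : ℂ) = ∑' n : ℕ, if n = 0 then (1 : ℂ) else 0 := by simp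
  rw [h1]
  refine tendsto_tsum_of_dominated_convergence
    (bound := fun n => ‖poch a n * poch b n / n.factorial‖ / ‖poch (C.re : ℂ) n‖) ?_ ?_ ?_
  · have h2 : 0 < ((C.re : ℂ)).re := by simpa using hC
    obtain ⟨A, hA, ha⟩ := norm_poch_le a
    obtain ⟨B, hB, hb⟩ := norm_poch_le b
    obtain ⟨K, hK, hc⟩ := le_norm_poch h2
    refine Summable.of_nonneg_of_le (fun n => by positivity) (fun n => ?_)
      ((summable_add_one_rpow (p := -1 - (C - a - b).re) (by linarith)).mul_left (A * B * K))
    have hp := norm_pos_iff.2 (poch_ne_zero_of_re_pos h2 n)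
    have hf : (0 : ℝ) < n.factorial := by positivity
    have hq : (0 : ℝ) < ((n : ℝ) + 1) ^ (C.re - 1) := by positivity
    rw [div_le_iff₀ hp, norm_div, norm_mul, Complex.norm_natCast, div_le_iff₀ hf]
    have hc' := hc n
    rw [Complex.ofReal_re] at hc'
    have e1 : ((n : ℝ) + 1) ^ (-1 - (C - a - b).re) * ((n : ℝ) + 1) ^ (C.re - 1) =
        ((n : ℝ) + 1) ^ (a.re - 1) * ((n : ℝ) + 1) ^ (b.re - 1) := by
      rw [← Real.rpow_add (by positivity), ← Real.rpow_add (by positivity)]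
      congr 1
      simp
      ring
    calc _ ≤ (A * n.factorial * ((n : ℝ) + 1) ^ (a.re - 1)) *
          (B * n.factorial * ((n : ℝ) + 1) ^ (b.re - 1)) :=
            mul_le_mul (ha n) (hb n) (norm_nonneg _) (by positivity)
      _ = A * B * n.factorial * ((n : ℝ) + 1) ^ (-1 - (C - a - b).re) *
          (n.factorial * ((n : ℝ) + 1) ^ (C.re - 1)) := by
            linear_combination (-(A * B * (n.factorial : ℝ) ^ 2)) * e1
      _ ≤ A * B * n.factorial * ((n : ℝ) + 1) ^ (-1 - (C - a - b).re) *
          (K * ‖poch (C.re : ℂ) n‖) := mul_le_mul_of_nonneg_left hc' (by positivity)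
      _ = _ := by ring
  · intro n
    cases n with
    | zero => simp
    | succ n =>
      simp only [Nat.succ_ne_zero, if_false]
      have hp := norm_pos_iff.2 (poch_ne_zero_of_re_pos
        (show 0 < ((C.re : ℂ)).re by simpa using hC) n)
      set D := ‖poch a (n + 1) * poch b (n + 1) / (n + 1).factorial‖ with hD
      have hz : Tendsto (fun k : ℕ => D / ‖poch (C.re : ℂ) n‖ * (1 / (k : ℝ))) atTop (𝓝 0) := by
        simpa using (tendsto_const_div_atTop_nhds_zero_nat (1 : ℝ)).const_mul
          (D / ‖poch (C.re : ℂ) n‖)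
      refine squeeze_zero_norm' ?_ hz
      filter_upwards [eventually_gt_atTop 0] with k hk
      have hk' : (0 : ℝ) < k := by exact_mod_cast hk
      rw [norm_div, ← hD, poch_succ_left, norm_mul, div_mul_div_comm, mul_one]
      refine div_le_div_of_nonneg_left (norm_nonneg _) (by positivity) ?_
      rw [mul_comm]
      refine mul_le_mul ?_ (norm_poch_mono hC ?_ n) (norm_nonneg _) (norm_nonneg _)
      · refine le_trans ?_ (Complex.re_le_norm _)
        simp
        exact hC.le
      · simp
        linarith
  · refine Eventually.of_forall fun k n => ?_
    rw [norm_div]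
    exact div_le_div_of_nonneg_left (norm_nonneg _)
      (norm_pos_iff.2 (poch_ne_zero_of_re_pos (by simpa using hC) n))
      (norm_poch_mono hC (by simp) n)

/-- Gauss's theorem `₂F₁(a, b; C; 1) = Γ(C) Γ(C - a - b) / (Γ(C - a) Γ(C - b))`, divided by `Γ(C)`
so that `C` may be a pole of `Γ`. -/
theorem hasSum_gaussTerm {a b C : ℂ} (h : 0 < (C - a - b).re) :
    HasSum (gaussTerm a b C)
      (Complex.Gamma (C - a - b) * (Complex.Gamma (C - a))⁻¹ * (Complex.Gamma (C - b))⁻¹) := by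
  have hre : ∀ {C : ℂ}, 0 < (C - a - b).re → 0 < (C + 1 - a - b).re := by
    intro C h
    simp only [Complex.sub_re, Complex.add_re, Complex.one_re] at h ⊢; linarith
  -- the right-hand side satisfies the same recurrence as the series
  have hrec : ∀ {C : ℂ}, 0 < (C - a - b).re → (C - a - b) * (Complex.Gamma (C - a - b) *
      (Complex.Gamma (C - a))⁻¹ * (Complex.Gamma (C - b))⁻¹) =
      (C - a) * (C - b) * (Complex.Gamma (C + 1 - a - b) *
      (Complex.Gamma (C + 1 - a))⁻¹ * (Complex.Gamma (C + 1 - b))⁻¹) := by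
    intro C h
    have h0 : C - a - b ≠ 0 := by intro h0; rw [h0] at h; simp at h
    rw [Complex.one_div_Gamma_eq_self_mul_one_div_Gamma_add_one (C - a),
      Complex.one_div_Gamma_eq_self_mul_one_div_Gamma_add_one (C - b),
      show C + 1 - a - b = C - a - b + 1 by ring, Complex.Gamma_add_one _ h0,
      show C + 1 - a = C - a + 1 by ring, show C + 1 - b = C - b + 1 by ring]
    ring
  suffices hmain : ∑' n, gaussTerm a b C n = Complex.Gamma (C - a - b) *
      (Complex.Gamma (C - a))⁻¹ * (Complex.Gamma (C - b))⁻¹ by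
    rw [← hmain]; exact (summable_gaussTerm h).hasSum
  -- the recurrence reduces the claim to the case where `Γ` has no poles at the arguments
  obtain ⟨k, hk⟩ := exists_nat_gt (max (-C.re) (max (-(C - a).re) (-(C - b).re)))
  induction k generalizing C with
  | zero =>
    simp only [Nat.cast_zero, max_lt_iff, neg_lt_zero] at hk
    obtain ⟨hC, hCa, hCb⟩ := hk
    have hsh : ∀ k : ℕ, 0 < (C + k - a - b).re := fun k => by
      have : C + k - a - b = C - a - b + k := by ring
      rw [this]; simp only [Complex.add_re, Complex.natCast_re]; positivity
    have hga : ∀ k : ℕ, Complex.Gamma (C - a + k) ≠ 0 := fun k =>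
      Complex.Gamma_ne_zero_of_re_pos (by
        simp only [Complex.add_re, Complex.natCast_re]; positivity)
    have hgb : ∀ k : ℕ, Complex.Gamma (C - b + k) ≠ 0 := fun k =>
      Complex.Gamma_ne_zero_of_re_pos (by
        simp only [Complex.add_re, Complex.natCast_re]; positivity)
    have hgab : ∀ k : ℕ, Complex.Gamma (C - a - b + k) ≠ 0 := fun k =>
      Complex.Gamma_ne_zero_of_re_pos (by
        simp only [Complex.add_re, Complex.natCast_re]; positivity)
    have hgC : ∀ k : ℕ, Complex.Gamma (C + k) ≠ 0 := fun k =>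
      Complex.Gamma_ne_zero_of_re_pos (by
        simp only [Complex.add_re, Complex.natCast_re]; positivity)
    -- `D k` is the quotient of the two sides at `C + k`; it is constant in `k` and tends to `1`
    set D : ℕ → ℂ := fun k => Complex.Gamma (C - a + k) * Complex.Gamma (C - b + k) /
      Complex.Gamma (C - a - b + k) * ∑' n, gaussTerm a b (C + k) n with hD
    have hstep : ∀ k, D (k + 1) = D k := by
      intro k
      have := tsum_gaussTerm_contiguous (hsh k)
      have na := add_natCast_ne_zero_of_re_pos hCa k
      have nb := add_natCast_ne_zero_of_re_pos hCb k
      have nab := add_natCast_ne_zero_of_re_pos h k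
      have e1 : ∀ z : ℂ, z + ((k + 1 : ℕ) : ℂ) = z + k + 1 := by intro z; push_cast; ring
      simp only [hD, e1]
      rw [Complex.Gamma_add_one _ na, Complex.Gamma_add_one _ nb, Complex.Gamma_add_one _ nab]
      rw [show C + k - a - b = C - a - b + k by ring, show C + k - a = C - a + k by ring,
        show C + k - b = C - b + k by ring] at this
      have g := hgab k
      field_simp
      linear_combination
        (-(Complex.Gamma (C - a + k) * Complex.Gamma (C - b + k))) * this
    have hconst : ∀ k, D k = D 0 := by
      intro k
      induction k with
      | zero => rfl
      | succ k ih => rw [hstep, ih]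
    have hlim : Tendsto D atTop (𝓝 1) := by
      have := (tendsto_Gamma_ratio hCa hCb h hC (by ring)).mul
        (tendsto_Gamma_mul_tsum_gaussTerm h hC)
      rw [one_mul] at this
      refine this.congr fun k => ?_
      have g1 := hgC k
      have g2 := hgab k
      simp only [hD]
      field_simp
    have hD0 : D 0 = 1 := by
      exact tendsto_nhds_unique (tendsto_const_nhds.congr fun k => (hconst k).symm) hlim
    have g1 := hga 0
    have g2 := hgb 0
    have g3 := hgab 0
    simp only [hD, Nat.cast_zero, add_zero] at hD0 g1 g2 g3
    field_simp at hD0 ⊢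
    linear_combination hD0
  | succ k ih =>
    have h0 : C - a - b ≠ 0 := by intro h0; rw [h0] at h; simp at h
    have hk' : max (-(C + 1).re) (max (-(C + 1 - a).re) (-(C + 1 - b).re)) < k := by
      simp only [max_lt_iff] at hk ⊢
      push_cast at hk
      simp only [Complex.sub_re, Complex.add_re, Complex.one_re] at hk ⊢
      refine ⟨?_, ?_, ?_⟩ <;> linarith [hk.1, hk.2.1, hk.2.2]
    refine mul_left_cancel₀ h0 ?_
    rw [hrec h, ← ih (hre h) hk', tsum_gaussTerm_contiguous h]

/-! ### Double series of Appell type -/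

theorem summable_add_one_rpow_mul_geometric (P : ℝ) {R : ℝ} (hR0 : 0 ≤ R) (hR : R < 1) :
    Summable fun n : ℕ => ((n : ℝ) + 1) ^ P * R ^ n := by
  obtain ⟨T, hRT, hT⟩ := exists_between hR
  have hT0 : 0 < T := hR0.trans_lt hRT
  obtain ⟨k, hk⟩ := exists_nat_gt P
  have h1 := summable_pow_mul_geometric_of_norm_lt_one k
    (show ‖T‖ < 1 by rwa [Real.norm_of_nonneg hT0.le])
  have h2 := ((summable_nat_add_iff 1).2 h1).mul_right T⁻¹
  refine Summable.of_nonneg_of_le (fun n => by positivity) (fun n => ?_) h2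
  have h3 : ((n : ℝ) + 1) ^ P ≤ ((n : ℝ) + 1) ^ k := by
    rw [← Real.rpow_natCast]
    exact Real.rpow_le_rpow_of_exponent_le (by linarith [(Nat.cast_nonneg n : (0 : ℝ) ≤ n)]) hk.le
  have h4 : R ^ n ≤ T ^ n := pow_le_pow_left₀ hR0 hRT.le n
  calc _ ≤ ((n : ℝ) + 1) ^ k * T ^ n := mul_le_mul h3 h4 (by positivity) (by positivity)
    _ = _ := by push_cast; rw [pow_succ]; field_simp

/-- A double geometric series with coefficients of polynomial growth converges. -/
theorem summable_prod_rpow_mul_geometric (P Q S : ℝ) {R : ℝ} (hR0 : 0 ≤ R) (hR : R < 1) :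
    Summable fun i : ℕ × ℕ => ((i.1 : ℝ) + 1) ^ P * ((i.2 : ℝ) + 1) ^ Q *
      (((i.1 + i.2 : ℕ) : ℝ) + 1) ^ S * R ^ (i.1 + i.2) := by
  have h := (summable_add_one_rpow_mul_geometric (P + |S|) hR0 hR).mul_of_nonneg
    (summable_add_one_rpow_mul_geometric (Q + |S|) hR0 hR)
    (fun n => by positivity) (fun n => by positivity)
  refine Summable.of_nonneg_of_le (fun i => by positivity) (fun i => ?_) h
  obtain ⟨m, n⟩ := i
  simp only
  have hm : (0 : ℝ) ≤ m := by positivity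
  have hn : (0 : ℝ) ≤ n := by positivity
  have h1 : (((m + n : ℕ) : ℝ) + 1) ^ S ≤ ((m : ℝ) + 1) ^ |S| * ((n : ℝ) + 1) ^ |S| := by
    rw [← Real.mul_rpow (by positivity) (by positivity)]
    refine (Real.rpow_le_rpow_of_exponent_le (by push_cast; linarith) (le_abs_self S)).trans ?_
    refine Real.rpow_le_rpow (by positivity) ?_ (abs_nonneg _)
    push_cast
    nlinarith
  calc _ ≤ ((m : ℝ) + 1) ^ P * ((n : ℝ) + 1) ^ Q *
        (((m : ℝ) + 1) ^ |S| * ((n : ℝ) + 1) ^ |S|) * R ^ (m + n) := by gcongr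
    _ = _ := by
      rw [Real.rpow_add (by positivity), Real.rpow_add (by positivity), pow_add]
      ring

/-- The coefficients of the double series which Pfaff's transformation in the second variable
turns `F₃(a, a', b, b'; c; u, v)` into. -/
noncomputable def pfaffCoeff (a a' b b' c : ℂ) (i : ℕ × ℕ) : ℂ :=
  poch a i.1 * poch b i.1 * poch a' i.2 * poch (c - b' + i.1) i.2 /
    (poch c (i.1 + i.2) * i.1.factorial * i.2.factorial)

/-- Growth of the coefficients, with exact exponents. -/
theorem norm_pfaffCoeff_le (a a' b b' : ℂ) {c : ℂ} (hc : 0 < c.re) :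
    ∃ K : ℝ, 0 < K ∧ ∀ i : ℕ × ℕ, ‖pfaffCoeff a a' b b' c i‖ ≤
      K * (((i.1 : ℝ) + 1) ^ ((a + b - c + b').re - 1) * ((i.2 : ℝ) + 1) ^ (a'.re - 1) *
        (((i.1 + i.2 : ℕ) : ℝ) + 1) ^ (-b'.re)) := by
  obtain ⟨A, hA, ha⟩ := norm_poch_le a
  obtain ⟨B, hB, hb⟩ := norm_poch_le b
  obtain ⟨A', hA', ha'⟩ := norm_poch_le a'
  obtain ⟨D, hD, hd⟩ := norm_poch_add_le (c - b')
  obtain ⟨K, hK, hk⟩ := le_norm_poch hc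
  refine ⟨A * B * A' * D * K, by positivity, fun i => ?_⟩
  obtain ⟨m, n⟩ := i
  simp only [pfaffCoeff]
  have hp := norm_pos_iff.2 (poch_ne_zero_of_re_pos hc (m + n))
  have hm : (0 : ℝ) < m.factorial := by positivity
  have hn : (0 : ℝ) < n.factorial := by positivity
  have hN : (0 : ℝ) < (m + n).factorial := by positivity
  rw [norm_div, norm_mul, norm_mul, norm_mul, norm_mul, norm_mul, Complex.norm_natCast,
    Complex.norm_natCast, div_le_iff₀ (by positivity)]
  set M : ℝ := (m : ℝ) + 1 with hM
  set T : ℝ := (n : ℝ) + 1 with hT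
  set N : ℝ := ((m + n : ℕ) : ℝ) + 1 with hNN
  have hM0 : 0 < M := by positivity
  have hN0 : 0 < N := by positivity
  have e1 : M ^ (a.re - 1) * M ^ (b.re - 1) * (N / M) ^ ((c - b').re - 1) =
      M ^ ((a + b - c + b').re - 1) * (N ^ (-b'.re) * N ^ (c.re - 1)) := by
    rw [Real.div_rpow hN0.le hM0.le, ← Real.rpow_add hM0, ← Real.rpow_add hN0, mul_div_assoc',
      div_eq_iff (by positivity), mul_right_comm, ← Real.rpow_add hM0]
    congr 2
    · simp only [Complex.sub_re, Complex.add_re]; ring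
    · simp only [Complex.sub_re]; ring
  calc _ ≤ (A * m.factorial * M ^ (a.re - 1)) * (B * m.factorial * M ^ (b.re - 1)) *
        (A' * n.factorial * T ^ (a'.re - 1)) *
        (D * ((m + n).factorial / m.factorial) * (N / M) ^ ((c - b').re - 1)) := by
          gcongr
          · exact ha m
          · exact hb m
          · exact ha' n
          · exact hd m n
    _ = A * B * A' * D * (M ^ (a.re - 1) * M ^ (b.re - 1) * (N / M) ^ ((c - b').re - 1)) *
          T ^ (a'.re - 1) * (m + n).factorial * m.factorial * n.factorial := by
          field_simp
    _ = A * B * A' * D * M ^ ((a + b - c + b').re - 1) * N ^ (-b'.re) * T ^ (a'.re - 1) *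
          m.factorial * n.factorial * ((m + n).factorial * N ^ (c.re - 1)) := by
          rw [e1]; ring
    _ ≤ A * B * A' * D * M ^ ((a + b - c + b').re - 1) * N ^ (-b'.re) * T ^ (a'.re - 1) *
          m.factorial * n.factorial * (K * ‖poch c (m + n)‖) :=
          mul_le_mul_of_nonneg_left (hk _) (by positivity)
    _ = _ := by ring

/-- The geometric majorant of the transformed double series on the bidisc of radius `R`. -/
theorem exists_summable_bound_pfaffCoeff (a a' b b' : ℂ) {c : ℂ} (hc : 0 < c.re) {R : ℝ}
    (hR0 : 0 ≤ R) (hR : R < 1) : ∃ B : ℕ × ℕ → ℝ, Summable B ∧ ∀ (w z : ℂ), ‖w‖ ≤ R → ‖z‖ ≤ R →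
      ∀ i, ‖pfaffCoeff a a' b b' c i * w ^ i.1 * z ^ i.2‖ ≤ B i := by
  obtain ⟨K, hK, h⟩ := norm_pfaffCoeff_le a a' b b' hc
  refine ⟨_, (summable_prod_rpow_mul_geometric ((a + b - c + b').re - 1) (a'.re - 1) (-b'.re)
    hR0 hR).mul_left K, fun w z hw hz i => ?_⟩
  rw [norm_mul, norm_mul, norm_pow, norm_pow, pow_add, mul_assoc, ← mul_assoc K]
  gcongr
  exact h i

theorem summable_pfaff (a a' b b' : ℂ) {c : ℂ} (hc : 0 < c.re) {w z : ℂ}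
    (hw : ‖w‖ < 1) (hz : ‖z‖ < 1) :
    Summable fun i : ℕ × ℕ => pfaffCoeff a a' b b' c i * w ^ i.1 * z ^ i.2 := by
  obtain ⟨B, hB, h⟩ := exists_summable_bound_pfaffCoeff a a' b b' hc
    (le_max_of_le_left (norm_nonneg w)) (max_lt hw hz)
  exact Summable.of_norm_bounded hB (h w z (le_max_left _ _) (le_max_right _ _))

theorem summable_appell (a a' b b' : ℂ) {c : ℂ} (hc : 0 < c.re) {w z : ℂ}
    (hw : ‖w‖ < 1) (hz : ‖z‖ < 1) :
    Summable fun i : ℕ × ℕ => poch a i.1 * poch a' i.2 * poch b i.1 * poch b' i.2 /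
      (poch c (i.1 + i.2) * i.1.factorial * i.2.factorial) * w ^ i.1 * z ^ i.2 := by
  obtain ⟨A, hA, ha⟩ := norm_poch_le a
  obtain ⟨B, hB, hb⟩ := norm_poch_le b
  obtain ⟨A', hA', ha'⟩ := norm_poch_le a'
  obtain ⟨B', hB', hb'⟩ := norm_poch_le b'
  obtain ⟨K, hK, hk⟩ := le_norm_poch hc
  set R : ℝ := max ‖w‖ ‖z‖ with hRdef
  have hR0 : 0 ≤ R := le_max_of_le_left (norm_nonneg w)
  refine Summable.of_norm_bounded ((summable_prod_rpow_mul_geometric ((a + b).re - 2)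
    ((a' + b').re - 2) (1 - c.re) hR0 (max_lt hw hz)).mul_left (A * B * A' * B' * K)) fun i => ?_
  obtain ⟨m, n⟩ := i
  simp only
  rw [norm_mul, norm_mul, norm_pow, norm_pow, pow_add, ← mul_assoc, ← mul_assoc]
  have hwR : ‖w‖ ≤ R := le_max_left _ _
  have hzR : ‖z‖ ≤ R := le_max_right _ _
  gcongr
  have hp := norm_pos_iff.2 (poch_ne_zero_of_re_pos hc (m + n))
  have hm : (0 : ℝ) < m.factorial := by positivity
  have hn : (0 : ℝ) < n.factorial := by positivity
  have hN : (0 : ℝ) < (m + n).factorial := by positivity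
  rw [norm_div, norm_mul, norm_mul, norm_mul, norm_mul, norm_mul, Complex.norm_natCast,
    Complex.norm_natCast, div_le_iff₀ (by positivity)]
  set M : ℝ := (m : ℝ) + 1 with hM
  set T : ℝ := (n : ℝ) + 1 with hT
  set N : ℝ := ((m + n : ℕ) : ℝ) + 1 with hNN
  have hM0 : 0 < M := by positivity
  have hT0 : 0 < T := by positivity
  have hN0 : 0 < N := by positivity
  have e1 : M ^ (a.re - 1) * M ^ (b.re - 1) = M ^ ((a + b).re - 2) := by
    rw [← Real.rpow_add hM0]; congr 1; simp; ring
  have e2 : T ^ (a'.re - 1) * T ^ (b'.re - 1) = T ^ ((a' + b').re - 2) := by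
    rw [← Real.rpow_add hT0]; congr 1; simp; ring
  have e3 : N ^ (1 - c.re) * N ^ (c.re - 1) = 1 := by
    rw [← Real.rpow_add hN0]; simp
  have hfac : (m.factorial : ℝ) * n.factorial ≤ (m + n).factorial := by
    exact_mod_cast Nat.le_of_dvd (Nat.factorial_pos _)
      (Nat.factorial_mul_factorial_dvd_factorial_add m n)
  calc _ ≤ (A * m.factorial * M ^ (a.re - 1)) * (A' * n.factorial * T ^ (a'.re - 1)) *
        (B * m.factorial * M ^ (b.re - 1)) * (B' * n.factorial * T ^ (b'.re - 1)) := by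
          gcongr
          · exact ha m
          · exact ha' n
          · exact hb m
          · exact hb' n
    _ = A * B * A' * B' * (M ^ (a.re - 1) * M ^ (b.re - 1)) *
          (T ^ (a'.re - 1) * T ^ (b'.re - 1)) * m.factorial * n.factorial *
          (m.factorial * n.factorial * (N ^ (1 - c.re) * N ^ (c.re - 1))) := by rw [e3]; ring
    _ ≤ A * B * A' * B' * (M ^ (a.re - 1) * M ^ (b.re - 1)) *
          (T ^ (a'.re - 1) * T ^ (b'.re - 1)) * m.factorial * n.factorial *
          ((m + n).factorial * (N ^ (1 - c.re) * N ^ (c.re - 1))) := by gcongr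
    _ = A * B * A' * B' * M ^ ((a + b).re - 2) * T ^ ((a' + b').re - 2) * N ^ (1 - c.re) *
          m.factorial * n.factorial * ((m + n).factorial * N ^ (c.re - 1)) := by
          rw [e1, e2]; ring
    _ ≤ A * B * A' * B' * M ^ ((a + b).re - 2) * T ^ ((a' + b').re - 2) * N ^ (1 - c.re) *
          m.factorial * n.factorial * (K * ‖poch c (m + n)‖) :=
          mul_le_mul_of_nonneg_left (hk _) (by positivity)
    _ = _ := by ring

/-! ### Pfaff's transformation and the continuation of Appell's function -/

/-- The binomial series. -/
theorem hasSum_poch_div_factorial (a : ℂ) {w : ℂ} (hw : ‖w‖ < 1) :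
    HasSum (fun k : ℕ => poch a k / k.factorial * w ^ k) ((1 - w) ^ (-a)) := by
  have h := (Complex.one_div_one_sub_cpow_hasFPowerSeriesOnBall_zero a).hasSum (y := w)
    (by simpa [enorm_eq_nnnorm, ← NNReal.coe_lt_coe] using hw)
  rw [Complex.cpow_neg]
  simp only [zero_add, one_div] at h
  refine h.congr_fun fun k => ?_
  rw [FormalMultilinearSeries.ofScalars_apply_eq, smul_eq_mul, ← Ring.multichoose_eq]
  congr 1
  have hk : (k.factorial : ℂ) ≠ 0 := by exact_mod_cast Nat.factorial_ne_zero k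
  rw [div_eq_iff hk, poch, mul_comm, ← nsmul_eq_mul,
    Ring.factorial_nsmul_multichoose_eq_ascPochhammer,
    Polynomial.ascPochhammer_smeval_eq_eval]

/-- Pfaff's transformation of `₂F₁`, near the origin. -/
theorem pfaff_transformation (a b : ℂ) {d w : ℂ} (hd : 0 < d.re) (hw : ‖w‖ < 1 / 2) :
    (1 - w) ^ (-a) * ∑' n : ℕ, poch a n * poch (d - b) n / (poch d n * n.factorial) *
        (w / (w - 1)) ^ n =
      ∑' n : ℕ, poch a n * poch b n / (poch d n * n.factorial) * w ^ n := by
  -- expand `(1 - w)^(-a-n)` in the `n`-th term and sum the resulting double series by diagonals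
  set F : ℕ × ℕ → ℂ := fun i => poch a (i.1 + i.2) * (poch (d - b) i.1 / poch d i.1) *
    (-1) ^ i.1 / (i.1.factorial * i.2.factorial) * w ^ (i.1 + i.2) with hF
  have hw1 : ‖w‖ < 1 := by linarith
  have h1w : 1 - w ≠ 0 := by
    intro h
    rw [sub_eq_zero] at h
    rw [← h] at hw1
    simp at hw1
  have hFs : Summable F := by
    obtain ⟨A, hA, ha⟩ := norm_poch_le a
    obtain ⟨B, hB, hb⟩ := norm_poch_le (d - b)
    obtain ⟨K, hK, hk⟩ := le_norm_poch hd
    refine Summable.of_norm_bounded ((summable_prod_rpow_mul_geometric (-b.re) 0 (a.re - 1)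
      (R := 2 * ‖w‖) (by positivity) (by linarith)).mul_left (A * B * K)) fun i => ?_
    obtain ⟨n, k⟩ := i
    simp only [hF, Real.rpow_zero, mul_one]
    have hp := norm_pos_iff.2 (poch_ne_zero_of_re_pos hd n)
    have hn : (0 : ℝ) < n.factorial := by positivity
    have hkf : (0 : ℝ) < k.factorial := by positivity
    have hratio : ‖poch (d - b) n / poch d n‖ ≤ B * K * ((n : ℝ) + 1) ^ (-b.re) := by
      rw [norm_div, div_le_iff₀ hp]
      refine (hb n).trans ?_
      have e : ((n : ℝ) + 1) ^ ((d - b).re - 1) =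
          ((n : ℝ) + 1) ^ (-b.re) * ((n : ℝ) + 1) ^ (d.re - 1) := by
        rw [← Real.rpow_add (by positivity)]; congr 1; simp; ring
      rw [e]
      calc _ = B * ((n : ℝ) + 1) ^ (-b.re) * (n.factorial * ((n : ℝ) + 1) ^ (d.re - 1)) := by ring
        _ ≤ B * ((n : ℝ) + 1) ^ (-b.re) * (K * ‖poch d n‖) :=
          mul_le_mul_of_nonneg_left (hk n) (by positivity)
        _ = _ := by ring
    have hfac : ((n + k).factorial : ℝ) ≤ 2 ^ (n + k) * (n.factorial * k.factorial) := by
      have h1 := Nat.add_choose_mul_factorial_mul_factorial n k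
      have h2 := Nat.choose_le_two_pow (n + k) k
      rw [← h1, mul_assoc]
      push_cast
      gcongr
      exact_mod_cast h2
    rw [norm_mul, norm_div, norm_mul, norm_mul, norm_mul, norm_pow, norm_pow, norm_neg, norm_one,
      one_pow, mul_one, Complex.norm_natCast, Complex.norm_natCast, mul_pow, ← mul_assoc,
      ← mul_assoc]
    gcongr
    rw [div_le_iff₀ (by positivity)]
    calc _ ≤ (A * (n + k).factorial * (((n + k : ℕ) : ℝ) + 1) ^ (a.re - 1)) *
          (B * K * ((n : ℝ) + 1) ^ (-b.re)) := by
            gcongr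
            exact ha (n + k)
      _ ≤ (A * (2 ^ (n + k) * (n.factorial * k.factorial)) *
          (((n + k : ℕ) : ℝ) + 1) ^ (a.re - 1)) * (B * K * ((n : ℝ) + 1) ^ (-b.re)) := by gcongr
      _ = _ := by ring
  have hrow : ∀ n : ℕ, ∑' k, F (n, k) = (1 - w) ^ (-a) *
      (poch a n * poch (d - b) n / (poch d n * n.factorial) * (w / (w - 1)) ^ n) := by
    intro n
    have hs := (hasSum_poch_div_factorial (a + n) hw1).mul_left
      (poch a n * (poch (d - b) n / poch d n) * (-1) ^ n / n.factorial * w ^ n)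
    have e : ∀ k, F (n, k) = poch a n * (poch (d - b) n / poch d n) * (-1) ^ n / n.factorial *
        w ^ n * (poch (a + n) k / k.factorial * w ^ k) := by
      intro k
      simp only [hF, poch_add, pow_add]
      have hn : (n.factorial : ℂ) ≠ 0 := by exact_mod_cast Nat.factorial_ne_zero n
      have hk : (k.factorial : ℂ) ≠ 0 := by exact_mod_cast Nat.factorial_ne_zero k
      field_simp
    simp only [e]
    rw [hs.tsum_eq, neg_add, Complex.cpow_add _ _ h1w, Complex.cpow_neg (1 - w) n,
      Complex.cpow_natCast, div_pow, show w - 1 = (-1) * (1 - w) by ring, mul_pow]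
    have h2 : ((-1 : ℂ) ^ n) * (-1) ^ n = 1 := by rw [← mul_pow]; simp
    have h3 : ((-1 : ℂ) ^ n)⁻¹ = (-1) ^ n := by 
      rw [inv_eq_iff_eq_inv, ← mul_eq_one_iff_eq_inv₀ (by simp)]; exact h2
    rw [div_eq_mul_inv (w ^ n), mul_inv, h3]
    simp only [div_eq_mul_inv, mul_inv]
    ring
  have hdiag : ∀ N : ℕ, ∑ i ∈ Finset.HasAntidiagonal.antidiagonal N, F i =
      poch a N * poch b N / (poch d N * N.factorial) * w ^ N := by
    intro N
    rw [Finset.Nat.sum_antidiagonal_eq_sum_range_succ_mk]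
    have h1 : ∀ n ∈ Finset.range N.succ, F (n, N - n) = poch a N / N.factorial * w ^ N *
        ((N.choose n : ℂ) * (-1) ^ n * (poch (d - b) n / poch d n)) := by
      intro n hn
      have hn' : n ≤ N := Nat.lt_succ_iff.1 (Finset.mem_range.1 hn)
      have h2 : ((N.choose n : ℂ)) * n.factorial * (N - n).factorial = N.factorial := by
        exact_mod_cast Nat.choose_mul_factorial_mul_factorial hn'
      have e1 : (n.factorial : ℂ) ≠ 0 := by exact_mod_cast Nat.factorial_ne_zero n
      have e2 : ((N - n).factorial : ℂ) ≠ 0 := by exact_mod_cast Nat.factorial_ne_zero (N - n)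
      have e3 : (N.factorial : ℂ) ≠ 0 := by exact_mod_cast Nat.factorial_ne_zero N
      have e4 : (N.choose n : ℂ) / N.factorial = 1 / (n.factorial * (N - n).factorial) := by
        rw [div_eq_div_iff e3 (mul_ne_zero e1 e2), ← h2]; ring
      simp only [hF, Nat.add_sub_cancel' hn']
      calc _ = poch a N * (poch (d - b) n / poch d n) * (-1) ^ n * w ^ N *
            (1 / (n.factorial * (N - n).factorial)) := by ring
        _ = _ := by rw [← e4]; ring
    rw [Finset.sum_congr rfl h1, ← Finset.mul_sum, sum_choose_mul_poch_div b hd]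
    simp only [div_eq_mul_inv, mul_inv]
    ring
  have hL : ∑' i, F i = (1 - w) ^ (-a) * ∑' n : ℕ, poch a n * poch (d - b) n /
      (poch d n * n.factorial) * (w / (w - 1)) ^ n := by
    rw [hFs.tsum_prod, ← tsum_mul_left]
    exact tsum_congr hrow
  rw [← hL, ← Finset.HasAntidiagonal.sigmaAntidiagonalEquivProd.tsum_eq F]
  refine (Finset.HasAntidiagonal.sigmaAntidiagonalEquivProd.summable_iff.2 hFs).tsum_sigma.trans
    (tsum_congr fun N => ?_)
  rw [← hdiag N, tsum_fintype]
  exact (Finset.sum_coe_sort (Finset.HasAntidiagonal.antidiagonal N) F)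

theorem starConvex_pfaff_region (u v : ℂ) {R : ℝ} (hR0 : 0 < R) (hR : R < 1) :
    StarConvex ℝ 0 {l : ℂ | ‖l * u‖ < R ∧ ‖l * v‖ < R * ‖1 - l * v‖} := by
  rw [starConvex_zero_iff]
  rintro l ⟨h1, h2⟩ s hs0 hs1
  refine ⟨?_, ?_⟩
  · rw [smul_mul_assoc, norm_smul, Real.norm_of_nonneg hs0]
    nlinarith [norm_nonneg (l * u)]
  · rw [smul_mul_assoc]
    set w := l * v with hw
    have hsq : ‖w‖ ^ 2 < R ^ 2 * ‖1 - w‖ ^ 2 := by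
      rw [← mul_pow]
      exact pow_lt_pow_left₀ h2 (norm_nonneg _) two_ne_zero
    have e : ∀ r : ℝ, ‖1 - r • w‖ ^ 2 = 1 - 2 * r * w.re + r ^ 2 * ‖w‖ ^ 2 := by
      intro r
      rw [← Complex.normSq_eq_norm_sq, ← Complex.normSq_eq_norm_sq, Complex.normSq_apply,
        Complex.normSq_apply]
      simp
      ring
    have e1 := e 1
    rw [one_smul] at e1
    rw [e1] at hsq
    refine lt_of_pow_lt_pow_left₀ 2 (by positivity) ?_
    rw [mul_pow, e s, norm_smul, Real.norm_of_nonneg hs0, mul_pow]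
    have hR2 : R ^ 2 < 1 := by nlinarith
    have hR3 : 0 < R ^ 2 := by positivity
    -- the difference of the two sides is convex in `s` and negative at both ends
    have hconv : 0 ≤ s * (1 - s) * (‖w‖ ^ 2 * (1 - R ^ 2)) := by
      have : 0 ≤ 1 - s := by linarith
      have : 0 ≤ 1 - R ^ 2 := by linarith
      positivity
    rcases hs0.eq_or_lt with h0 | h0
    · rw [← h0]; simp; positivity
    · have h3 := mul_lt_mul_of_pos_left hsq h0
      have h4 : 0 ≤ (1 - s) * R ^ 2 := mul_nonneg (by linarith) hR3.le
      nlinarith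

/-- On the disc `‖w‖ < R ‖1 - w‖` the point `1 - w` lies in the right half plane. -/
theorem one_sub_mem_slitPlane {R : ℝ} (hR : R < 1) {w : ℂ} (h : ‖w‖ < R * ‖1 - w‖) :
    1 - w ∈ Complex.slitPlane := by
  left
  have h1 : ‖w‖ < ‖1 - w‖ := h.trans_le (by nlinarith [norm_nonneg (1 - w)])
  have h2 : ‖w‖ ^ 2 < ‖1 - w‖ ^ 2 := pow_lt_pow_left₀ h1 (norm_nonneg _) two_ne_zero
  rw [← Complex.normSq_eq_norm_sq, ← Complex.normSq_eq_norm_sq, Complex.normSq_apply,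
    Complex.normSq_apply] at h2
  simp at h2 ⊢
  nlinarith

theorem norm_div_sub_one_lt {R : ℝ} (hR : R < 1) {w : ℂ} (h : ‖w‖ < R * ‖1 - w‖) :
    ‖w / (w - 1)‖ < R := by
  have hne := Complex.slitPlane_ne_zero (one_sub_mem_slitPlane hR h)
  rw [norm_div, norm_sub_rev w 1, div_lt_iff₀ (norm_pos_iff.2 hne)]
  exact h

/-- The continuation of the Appell series supplied by Pfaff's transformation in the second
variable. -/
theorem isAppellF3Continuation_pfaff (a a' b b' : ℂ) {c : ℂ} (hc : 0 < c.re) {u v : ℂ} {R : ℝ}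
    (hR : R < 1) (hu : ‖u‖ < R) (hv : ‖v‖ < R * ‖1 - v‖) :
    IsAppellF3Continuation a a' b b' c u v
      {l : ℂ | ‖l * u‖ < R ∧ ‖l * v‖ < R * ‖1 - l * v‖}
      (fun l => (1 - l * v) ^ (-a') *
        ∑' i : ℕ × ℕ, pfaffCoeff a a' b b' c i * (l * u) ^ i.1 * (l * v / (l * v - 1)) ^ i.2) := by
  have hR0 : 0 < R := (norm_nonneg u).trans_lt hu
  have hopen : IsOpen {l : ℂ | ‖l * u‖ < R ∧ ‖l * v‖ < R * ‖1 - l * v‖} := by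
    rw [Set.ofPred_and]
    exact (isOpen_lt (by fun_prop) (by fun_prop)).inter (isOpen_lt (by fun_prop) (by fun_prop))
  refine ⟨hopen, starConvex_pfaff_region u v hR0 hR, by simpa using ⟨hu, hv⟩, ?_, ?_⟩
  · refine DifferentiableOn.mul ?_ ?_
    · intro l hl
      refine DifferentiableAt.differentiableWithinAt ?_
      exact DifferentiableAt.cpow (by fun_prop) (by fun_prop) (one_sub_mem_slitPlane hR hl.2)
    · obtain ⟨B, hB, hbound⟩ := exists_summable_bound_pfaffCoeff a a' b b' hc hR0.le hR
      refine Complex.differentiableOn_tsum_of_summable_norm hB (fun i => ?_) hopen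
        fun i l hl => hbound _ _ hl.1.le (norm_div_sub_one_lt hR hl.2).le i
      intro l hl
      have hne := Complex.slitPlane_ne_zero (one_sub_mem_slitPlane hR hl.2)
      have hne' : l * v - 1 ≠ 0 := by
        intro h; apply hne; linear_combination -h
      refine DifferentiableAt.differentiableWithinAt ?_
      fun_prop (disch := assumption)
  · have h1 : ∀ᶠ l in 𝓝 (0 : ℂ), ‖l * u‖ < 1 / 2 := by
      have : ContinuousAt (fun l : ℂ => ‖l * u‖) 0 := by fun_prop
      exact this.eventually_lt continuousAt_const (by simp)
    have h2 : ∀ᶠ l in 𝓝 (0 : ℂ), ‖l * v‖ < 1 / 2 := by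
      have : ContinuousAt (fun l : ℂ => ‖l * v‖) 0 := by fun_prop
      exact this.eventually_lt continuousAt_const (by simp)
    filter_upwards [h1, h2] with l hl1 hl2
    have hw : ‖l * u‖ < 1 := by linarith
    have hz : ‖l * v / (l * v - 1)‖ < 1 := by
      have h3 : 1 / 2 < ‖l * v - 1‖ := by
        have := norm_sub_norm_le 1 (l * v)
        rw [norm_one, norm_sub_rev] at this
        linarith
      rw [norm_div, div_lt_one (by linarith)]
      linarith
    have hs1 := summable_pfaff a a' b b' hc hw hz
    have hs2 := summable_appell a a' b b' hc hw (show ‖l * v‖ < 1 by linarith)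
    have hser : appellF3Series a a' b b' c (l * u) (l * v) = ∑' i : ℕ × ℕ,
        poch a i.1 * poch a' i.2 * poch b i.1 * poch b' i.2 /
        (poch c (i.1 + i.2) * i.1.factorial * i.2.factorial) * (l * u) ^ i.1 * (l * v) ^ i.2 := rfl
    rw [hser, hs1.tsum_prod, hs2.tsum_prod, ← tsum_mul_left]
    refine tsum_congr fun m => ?_
    have hcm : 0 < (c + m).re := by simp; positivity
    have hP := pfaff_transformation a' b' hcm hl2
    have e1 : ∀ n : ℕ, pfaffCoeff a a' b b' c (m, n) * (l * u) ^ m * (l * v / (l * v - 1)) ^ n =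
        poch a m * poch b m / (poch c m * m.factorial) * (l * u) ^ m *
        (poch a' n * poch (c + m - b') n / (poch (c + m) n * n.factorial) *
          (l * v / (l * v - 1)) ^ n) := by
      intro n
      rw [pfaffCoeff, poch_add, show c - b' + m = c + m - b' by ring]
      simp only [div_eq_mul_inv, mul_inv]
      ring
    have e2 : ∀ n : ℕ, poch a m * poch a' n * poch b m * poch b' n /
        (poch c (m + n) * m.factorial * n.factorial) * (l * u) ^ m * (l * v) ^ n =
        poch a m * poch b m / (poch c m * m.factorial) * (l * u) ^ m *
        (poch a' n * poch b' n / (poch (c + m) n * n.factorial) * (l * v) ^ n) := by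
      intro n
      rw [poch_add]
      simp only [div_eq_mul_inv, mul_inv]
      ring
    simp only [e1, e2]
    rw [tsum_mul_left, tsum_mul_left, ← hP]
    ring

/-- The double series of `pfaffCoeff` on the diagonal. -/
noncomputable def pfaffSeries (a a' b b' c u : ℂ) : ℂ :=
  ∑' i : ℕ × ℕ, pfaffCoeff a a' b b' c i * u ^ i.1 * u ^ i.2

/-- Appell's function at the argument of the kernel: `(1 - s, 1 - 1 / s)` is sent to the diagonal
by Pfaff's transformation in the second variable. -/
theorem appellF3_eq_cpow_mul_pfaffSeries (a a' b b' : ℂ) {c : ℂ} (hc : 0 < c.re) {s : ℝ}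
    (hs0 : 0 < s) (hs1 : s < 1) :
    appellF3 a a' b b' c ((1 - s : ℝ) : ℂ) ((1 - s⁻¹ : ℝ) : ℂ) =
      (s : ℂ) ^ a' * pfaffSeries a a' b b' c (1 - s) := by
  obtain ⟨R, hR1, hR2⟩ := exists_between (show 1 - s < 1 by linarith)
  have hinv : 1 < s⁻¹ := (one_lt_inv₀ hs0).2 hs1
  have hu : ‖((1 - s : ℝ) : ℂ)‖ < R := by
    rw [Complex.norm_real, Real.norm_of_nonneg (by linarith)]; exact hR1
  have hv : ‖((1 - s⁻¹ : ℝ) : ℂ)‖ < R * ‖1 - ((1 - s⁻¹ : ℝ) : ℂ)‖ := by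
    rw [Complex.norm_real, Real.norm_of_nonpos (by linarith), ← Complex.ofReal_one,
      ← Complex.ofReal_sub, Complex.norm_real, sub_sub_cancel,
      Real.norm_of_nonneg (by positivity)]
    have : s⁻¹ - 1 = (1 - s) * s⁻¹ := by field_simp
    have h3 := mul_lt_mul_of_pos_right hR1 (inv_pos.2 hs0)
    linarith
  rw [appellF3_eq (isAppellF3Continuation_pfaff a a' b b' hc hR2 hu hv)]
  have hsc : (s : ℂ) ≠ 0 := by exact_mod_cast hs0.ne'
  have e1 : ((1 - s⁻¹ : ℝ) : ℂ) / (((1 - s⁻¹ : ℝ) : ℂ) - 1) = 1 - s := by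
    push_cast
    rw [show (1 - (s : ℂ)⁻¹ - 1) = -(s : ℂ)⁻¹ by ring]
    field_simp
    ring
  have e2 : (1 - ((1 - s⁻¹ : ℝ) : ℂ)) ^ (-a') = (s : ℂ) ^ a' := by
    rw [show 1 - ((1 - s⁻¹ : ℝ) : ℂ) = (s : ℂ)⁻¹ by push_cast; ring, Complex.inv_cpow,
      Complex.cpow_neg, inv_inv]
    rw [Complex.arg_ofReal_of_nonneg hs0.le]
    exact Real.pi_ne_zero.symm
  simp only [one_mul, e1, e2, pfaffSeries]
  push_cast
  rfl

/-- A contiguous relation which raises the parameter `a'`. -/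
theorem pfaffSeries_contiguous (a a' b b' : ℂ) {c u : ℂ} (hc : 0 < c.re) (hu : ‖u‖ < 1) :
    pfaffSeries a a' b b' c u = (1 - u) * pfaffSeries a (a' + 1) b b' c u +
      b' / c * (u * pfaffSeries a (a' + 1) b (b' + 1) (c + 1) u) := by
  have hc0 : c ≠ 0 := by rintro rfl; simp at hc
  have hc1 : 0 < (c + 1).re := by simp; linarith
  have hf := summable_pfaff a a' b b' hc hu hu
  have hg := summable_pfaff a (a' + 1) b b' hc hu hu
  have hh := summable_pfaff a (a' + 1) b (b' + 1) hc1 hu hu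
  have hterm : ∀ m n : ℕ, pfaffCoeff a a' b b' c (m, n + 1) = pfaffCoeff a (a' + 1) b b' c (m, n + 1)
      - pfaffCoeff a (a' + 1) b b' c (m, n) +
      b' / c * pfaffCoeff a (a' + 1) b (b' + 1) (c + 1) (m, n) := by
    intro m n
    have n1 := poch_ne_zero_of_re_pos hc (m + n)
    have n2 := add_natCast_ne_zero_of_re_pos hc (m + n)
    have hm : (m.factorial : ℂ) ≠ 0 := by exact_mod_cast Nat.factorial_ne_zero m
    have hn : (n.factorial : ℂ) ≠ 0 := by exact_mod_cast Nat.factorial_ne_zero n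
    have hn1 : (n : ℂ) + 1 ≠ 0 := by exact_mod_cast Nat.succ_ne_zero n
    have e1 : poch (c + 1) (m + n) = poch c (m + n) * (c + (m + n : ℕ)) / c := by
      rw [← poch_succ, poch_succ_left]; field_simp
    simp only [pfaffCoeff]
    rw [poch_succ_left a' n, poch_succ (a' + 1) n, ← add_assoc, poch_succ c (m + n), poch_succ _ n,
      Nat.factorial_succ, e1, show c + 1 - (b' + 1) + m = c - b' + m by ring]
    push_cast at n2 ⊢
    field_simp
    ring
  have hterm0 : ∀ m : ℕ, pfaffCoeff a a' b b' c (m, 0) = pfaffCoeff a (a' + 1) b b' c (m, 0) := by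
    intro m
    simp [pfaffCoeff]
  rw [pfaffSeries, pfaffSeries, pfaffSeries, hf.tsum_prod, hg.tsum_prod, hh.tsum_prod,
    ← tsum_mul_left, ← tsum_mul_left, ← tsum_mul_left, ← (hg.prod.mul_left _).tsum_add
      ((hh.prod.mul_left _).mul_left _)]
  refine tsum_congr fun m => ?_
  have hfm := hf.prod_factor m
  have hgm := hg.prod_factor m
  have hhm := hh.prod_factor m
  simp only at hfm hgm hhm ⊢
  have hgm' := (summable_nat_add_iff 1).2 hgm
  have h1 := (hgm'.sub (hgm.mul_left u)).add ((hhm.mul_left u).mul_left (b' / c))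
  rw [hfm.tsum_eq_zero_add, sub_mul, one_mul]
  have h2 : ∀ n : ℕ, pfaffCoeff a a' b b' c (m, n + 1) * u ^ m * u ^ (n + 1) =
      (pfaffCoeff a (a' + 1) b b' c (m, n + 1) * u ^ m * u ^ (n + 1) -
        u * (pfaffCoeff a (a' + 1) b b' c (m, n) * u ^ m * u ^ n)) +
      b' / c * (u * (pfaffCoeff a (a' + 1) b (b' + 1) (c + 1) (m, n) * u ^ m * u ^ n)) := by
    intro n
    rw [hterm]
    ring
  simp only [h2]
  rw [Summable.tsum_add (hgm'.sub (hgm.mul_left u)) ((hhm.mul_left u).mul_left (b' / c)),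
    Summable.tsum_sub hgm' (hgm.mul_left u), tsum_mul_left, tsum_mul_left, tsum_mul_left,
    hterm0]
  conv_rhs => rw [hgm.tsum_eq_zero_add]
  rw [hgm.tsum_eq_zero_add]
  ring

/-! ### Moments of the kernel -/

/-- Termwise integration of an absolutely convergent series, with integrability of the sum. -/
theorem integrable_and_hasSum_integral {X ι : Type*} [MeasurableSpace X] {μ : Measure X}
    [Countable ι] {F : ι → X → ℂ} {f : X → ℂ} (hF : ∀ i, Integrable (F i) μ)
    (hsum : Summable fun i => ∫ a, ‖F i a‖ ∂μ) (hlim : ∀ᵐ a ∂μ, HasSum (fun i => F i a) (f a)) :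
    Integrable f μ ∧ HasSum (fun i => ∫ a, F i a ∂μ) (∫ a, f a ∂μ) := by
  constructor
  · refine ⟨aestronglyMeasurable_of_tendsto_ae (u := (atTop : Filter (Finset ι)))
      (f := fun S a => ∑ i ∈ S, F i a) ?_ ?_, ?_⟩
    · intro S
      exact (integrable_finsetSum S fun i _ => hF i).1
    · filter_upwards [hlim] with a ha using ha
    · have hle : ∫⁻ a, ‖f a‖ₑ ∂μ ≤ ∫⁻ a, ∑' i, ‖F i a‖ₑ ∂μ := by
        refine lintegral_mono_ae ?_
        filter_upwards [hlim] with a ha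
        rw [← ha.tsum_eq]
        exact enorm_tsum_le_tsum_enorm
      refine hle.trans_lt ?_
      rw [lintegral_tsum fun i => (hF i).1.enorm]
      have h1 : ∀ i, ∫⁻ a, ‖F i a‖ₑ ∂μ = ENNReal.ofReal (∫ a, ‖F i a‖ ∂μ) := fun i =>
        (ofReal_integral_norm_eq_lintegral_enorm (hF i)).symm
      simp only [h1]
      rw [← ENNReal.ofReal_tsum_of_nonneg (fun i => integral_nonneg fun a => norm_nonneg _) hsum]
      exact ENNReal.ofReal_lt_top
  · have h := hasSum_integral_of_summable_integral_norm hF hsum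
    rwa [integral_congr_ae (g := f) (by filter_upwards [hlim] with a ha using ha.tsum_eq)] at h

/-- Convergence of the double series of powers which dominates the moments. -/
theorem summable_prod_rpow {p q E : ℝ} (hq : 0 < q) (hqE : q < E) (hpq : p + q < E) :
    Summable fun i : ℕ × ℕ => ((i.1 : ℝ) + 1) ^ (p - 1) * ((i.2 : ℝ) + 1) ^ (q - 1) *
      (((i.1 + i.2 : ℕ) : ℝ) + 1) ^ (-E) := by
  -- `p` may be increased to a positive number, after which `E` is split between both indices
  set P : ℝ := max p ((E - q) / 2) with hP
  have hP0 : 0 < P := lt_max_of_lt_right (by linarith)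
  have hPq : P + q < E := by
    rcases max_cases p ((E - q) / 2) with h | h <;> rw [hP, h.1] <;> linarith
  set e : ℝ := (E - P - q) / 2 with he
  have he0 : 0 < e := by rw [he]; linarith
  have h := (summable_add_one_rpow (p := -1 - e) (by linarith)).mul_of_nonneg
    (summable_add_one_rpow (p := -1 - e) (by linarith))
    (fun n => by positivity) (fun n => by positivity)
  refine Summable.of_nonneg_of_le (fun i => by positivity) (fun i => ?_) h
  obtain ⟨m, n⟩ := i
  simp only
  have hm : (0 : ℝ) ≤ m := by positivity
  have hn : (0 : ℝ) ≤ n := by positivity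
  set M : ℝ := (m : ℝ) + 1 with hM
  set T : ℝ := (n : ℝ) + 1 with hT
  set N : ℝ := ((m + n : ℕ) : ℝ) + 1 with hN
  have hM1 : 1 ≤ M := by linarith
  have hT1 : 1 ≤ T := by linarith
  have hMN : M ≤ N := by rw [hN]; push_cast; linarith
  have hTN : T ≤ N := by rw [hN]; push_cast; linarith
  have h1 : M ^ (p - 1) ≤ M ^ (P - 1) :=
    Real.rpow_le_rpow_of_exponent_le hM1 (by linarith [le_max_left p ((E - q) / 2)])
  have h2 : N ^ (-E) ≤ M ^ (-(P + e)) * T ^ (-(q + e)) := by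
    rw [show -E = -(P + e) + -(q + e) by rw [he]; ring, Real.rpow_add (by linarith)]
    refine mul_le_mul (Real.rpow_le_rpow_of_nonpos (by linarith) hMN (by linarith))
      (Real.rpow_le_rpow_of_nonpos (by linarith) hTN (by linarith)) ?_ ?_ <;> positivity
  calc _ ≤ M ^ (P - 1) * T ^ (q - 1) * (M ^ (-(P + e)) * T ^ (-(q + e))) := by gcongr
    _ = (M ^ (P - 1) * M ^ (-(P + e))) * (T ^ (q - 1) * T ^ (-(q + e))) := by ring
    _ = _ := by
      rw [← Real.rpow_add (by linarith), ← Real.rpow_add (by linarith)]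
      congr 2 <;> ring

theorem integrableOn_beta {r c : ℂ} (hr : 0 < r.re) (hc : 0 < c.re) :
    IntegrableOn (fun s : ℝ => (s : ℂ) ^ (r - 1) * (1 - (s : ℂ)) ^ (c - 1)) (Set.Ioo 0 1) :=
  (intervalIntegrable_iff_integrableOn_Ioo_of_le zero_le_one).1
    (Complex.betaIntegral_convergent hr hc)

theorem integral_beta {r c : ℂ} (hr : 0 < r.re) (hc : 0 < c.re) :
    ∫ s in Set.Ioo (0 : ℝ) 1, (s : ℂ) ^ (r - 1) * (1 - (s : ℂ)) ^ (c - 1) =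
      Complex.Gamma r * Complex.Gamma c * (Complex.Gamma (r + c))⁻¹ := by
  rw [← div_eq_mul_inv, ← Complex.betaIntegral_eq_Gamma_mul_div r c hr hc, Complex.betaIntegral,
    intervalIntegral.integral_of_le zero_le_one, integral_Ioc_eq_integral_Ioo]

theorem integral_norm_beta {r c : ℂ} (hr : 0 < r.re) (hc : 0 < c.re) :
    ∫ s in Set.Ioo (0 : ℝ) 1, ‖(s : ℂ) ^ (r - 1) * (1 - (s : ℂ)) ^ (c - 1)‖ =
      ‖Complex.Gamma r.re * Complex.Gamma c.re * (Complex.Gamma (r.re + c.re))⁻¹‖ := by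
  rw [← integral_beta (r := r.re) (c := c.re) (by simpa using hr) (by simpa using hc)]
  have h : ∀ s ∈ Set.Ioo (0 : ℝ) 1, (s : ℂ) ^ ((r.re : ℂ) - 1) * (1 - (s : ℂ)) ^ ((c.re : ℂ) - 1) =
      ((‖(s : ℂ) ^ (r - 1) * (1 - (s : ℂ)) ^ (c - 1)‖ : ℝ) : ℂ) := by
    intro s hs
    have h1 : (0 : ℝ) < 1 - s := by linarith [hs.2]
    have h2 : 1 - (s : ℂ) = ((1 - s : ℝ) : ℂ) := by push_cast; rfl
    rw [norm_mul, h2,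
      Complex.norm_cpow_eq_rpow_re_of_pos hs.1, Complex.norm_cpow_eq_rpow_re_of_pos h1,
      Complex.ofReal_mul, Complex.ofReal_cpow hs.1.le, Complex.ofReal_cpow h1.le]
    simp
  rw [setIntegral_congr_fun measurableSet_Ioo h, integral_complex_ofReal, Complex.norm_real,
    Real.norm_of_nonneg (integral_nonneg fun s => norm_nonneg _)]

/-- The Beta function decays like `N^(-Re r)`. -/
theorem norm_beta_le (r : ℝ) {c : ℝ} (hc : 0 < c) : ∃ K : ℝ, 0 < K ∧ ∀ N : ℕ,
    ‖Complex.Gamma r * Complex.Gamma ((c + N : ℝ) : ℂ) *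
      (Complex.Gamma (r + ((c + N : ℝ) : ℂ)))⁻¹‖ ≤ K * ((N : ℝ) + 1) ^ (-r) := by
  obtain ⟨A, hA, ha⟩ := norm_poch_le (c : ℂ)
  obtain ⟨B, hB, hb⟩ := norm_inv_Gamma_add_natCast_le ((r + c : ℝ) : ℂ)
  refine ⟨(‖Complex.Gamma r‖ * ‖Complex.Gamma c‖ + 1) * A * B, by positivity, fun N => ?_⟩
  have hf : (0 : ℝ) < N.factorial := by positivity
  have e1 : Complex.Gamma ((c + N : ℝ) : ℂ) = poch c N * Complex.Gamma c := by
    rw [← Gamma_add_natCast_of_re_pos (by simpa using hc)]; push_cast; rfl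
  have e2 : (r : ℂ) + ((c + N : ℝ) : ℂ) = ((r + c : ℝ) : ℂ) + N := by push_cast; ring
  rw [e1, e2, norm_mul, norm_mul, norm_mul]
  have hb' : ‖(Complex.Gamma (((r + c : ℝ) : ℂ) + N))⁻¹‖ ≤
      B * ((N : ℝ) + 1) ^ (1 - (r + c)) / N.factorial := by
    rw [le_div_iff₀ hf, mul_comm]; simpa using hb N
  have ha' : ‖poch c N‖ ≤ A * N.factorial * ((N : ℝ) + 1) ^ (c - 1) := by simpa using ha N
  have e3 : ((N : ℝ) + 1) ^ (-r) = ((N : ℝ) + 1) ^ (c - 1) * ((N : ℝ) + 1) ^ (1 - (r + c)) := by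
    rw [← Real.rpow_add (by positivity)]; congr 1; ring
  calc _ ≤ ‖Complex.Gamma r‖ * (A * N.factorial * ((N : ℝ) + 1) ^ (c - 1) * ‖Complex.Gamma c‖) *
        (B * ((N : ℝ) + 1) ^ (1 - (r + c)) / N.factorial) := by gcongr
    _ = (‖Complex.Gamma r‖ * ‖Complex.Gamma c‖) * A * B * ((N : ℝ) + 1) ^ (-r) := by
      rw [e3]; field_simp
    _ ≤ _ := by
      gcongr
      linarith

/-- The kernel on `(0, 1)`, after Pfaff's transformation, multiplied by `s^(r - 1)`. -/
noncomputable def momentIntegrand (a a' b b' c r : ℂ) (s : ℝ) : ℂ :=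
  (s : ℂ) ^ (r - 1) * (1 - (s : ℂ)) ^ (c - 1) * pfaffSeries a a' b b' c (1 - s)

/-- The value of the moment `∫₀¹ s^(r-1) (1-s)^(c-1) H(1-s) ds`. -/
noncomputable def momentValue (a a' b b' c r : ℂ) : ℂ :=
  Complex.Gamma c * (Complex.Gamma r * Complex.Gamma (r + c - a - a' - b) *
    Complex.Gamma (r + b' - a')) * ((Complex.Gamma (r + b'))⁻¹ *
    (Complex.Gamma (r + c - a - a'))⁻¹ * (Complex.Gamma (r + c - a' - b))⁻¹)

/-- Summation of the integrated double series by two applications of Gauss's theorem. -/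
theorem tsum_pfaffCoeff_mul_beta {a a' b b' c r : ℂ} (hc : 0 < c.re)
    (h1 : 0 < (r + b' - a').re) (h2 : 0 < (r + c - a - a' - b).re)
    (hs : Summable fun i : ℕ × ℕ => pfaffCoeff a a' b b' c i *
      (Complex.Gamma r * Complex.Gamma (c + (i.1 + i.2 : ℕ)) *
        (Complex.Gamma (r + (c + (i.1 + i.2 : ℕ))))⁻¹)) :
    ∑' i : ℕ × ℕ, pfaffCoeff a a' b b' c i *
      (Complex.Gamma r * Complex.Gamma (c + (i.1 + i.2 : ℕ)) *
        (Complex.Gamma (r + (c + (i.1 + i.2 : ℕ))))⁻¹) = momentValue a a' b b' c r := by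
  rw [hs.tsum_prod]
  have hinner : ∀ m : ℕ, ∑' n : ℕ, pfaffCoeff a a' b b' c (m, n) *
      (Complex.Gamma r * Complex.Gamma (c + (m + n : ℕ)) *
        (Complex.Gamma (r + (c + (m + n : ℕ))))⁻¹) =
      Complex.Gamma c * Complex.Gamma r * Complex.Gamma (r + b' - a') *
        (Complex.Gamma (r + b'))⁻¹ * gaussTerm a b (r + c - a') m := by
    intro m
    have hG := hasSum_gaussTerm (a := a') (b := c - b' + m) (C := r + c + m)
      (by rwa [show r + c + m - a' - (c - b' + m) = r + b' - a' by ring])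
    have e : ∀ n : ℕ, pfaffCoeff a a' b b' c (m, n) *
        (Complex.Gamma r * Complex.Gamma (c + (m + n : ℕ)) *
        (Complex.Gamma (r + (c + (m + n : ℕ))))⁻¹) =
        Complex.Gamma c * Complex.Gamma r * (poch a m * poch b m / m.factorial) *
          gaussTerm a' (c - b' + m) (r + c + m) n := by
      intro n
      have hp := poch_ne_zero_of_re_pos hc (m + n)
      rw [Gamma_add_natCast_of_re_pos hc, pfaffCoeff, gaussTerm,
        show r + (c + ((m + n : ℕ) : ℂ)) = r + c + m + n by push_cast; ring]
      field_simp
    simp only [e]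
    rw [tsum_mul_left, hG.tsum_eq, gaussTerm,
      show r + c + m - a' - (c - b' + m) = r + b' - a' by ring,
      show r + c + m - (c - b' + m) = r + b' by ring,
      show r + c + m - a' = r + c - a' + m by ring]
    ring
  simp only [hinner]
  have hG := hasSum_gaussTerm (a := a) (b := b) (C := r + c - a')
    (by rwa [show r + c - a' - a - b = r + c - a - a' - b by ring])
  rw [tsum_mul_left, hG.tsum_eq, momentValue,
    show r + c - a' - a - b = r + c - a - a' - b by ring,
    show r + c - a' - a = r + c - a - a' by ring]
  ring

/-- The moment formula when `Re a' > 0`: the double series may be integrated termwise. -/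
theorem moment_of_re_pos {a a' b b' c r : ℂ} (ha' : 0 < a'.re) (hc : 0 < c.re) (hr : 0 < r.re)
    (h1 : 0 < (r + b' - a').re) (h2 : 0 < (r + c - a - a' - b).re) :
    IntegrableOn (momentIntegrand a a' b b' c r) (Set.Ioo 0 1) ∧
      ∫ s in Set.Ioo (0 : ℝ) 1, momentIntegrand a a' b b' c r s = momentValue a a' b b' c r := by
  have hcN : ∀ N : ℕ, 0 < (c + N).re := fun N => by simp; positivity
  set F : ℕ × ℕ → ℝ → ℂ := fun i s => pfaffCoeff a a' b b' c i *
    ((s : ℂ) ^ (r - 1) * (1 - (s : ℂ)) ^ (c + (i.1 + i.2 : ℕ) - 1)) with hF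
  have hint : ∀ i, IntegrableOn (F i) (Set.Ioo 0 1) := fun i =>
    (integrableOn_beta hr (hcN _)).const_mul _
  have hnorm : ∀ i, ∫ s in Set.Ioo (0 : ℝ) 1, ‖F i s‖ = ‖pfaffCoeff a a' b b' c i‖ *
      ‖Complex.Gamma r.re * Complex.Gamma ((c.re + (i.1 + i.2 : ℕ) : ℝ) : ℂ) *
        (Complex.Gamma (r.re + ((c.re + (i.1 + i.2 : ℕ) : ℝ) : ℂ)))⁻¹‖ := by
    intro i
    have := integral_norm_beta hr (hcN (i.1 + i.2))
    rw [Complex.add_re, Complex.natCast_re] at this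
    rw [← this, ← integral_const_mul]
    simp only [hF, norm_mul]
  have hsum : Summable fun i => ∫ s in Set.Ioo (0 : ℝ) 1, ‖F i s‖ := by
    obtain ⟨A, hA, hcoef⟩ := norm_pfaffCoeff_le a a' b b' hc
    obtain ⟨B, hB, hbeta⟩ := norm_beta_le r.re hc
    simp only [Complex.sub_re, Complex.add_re] at h1 h2
    have hmaj := (summable_prod_rpow (p := (a + b - c + b').re) (q := a'.re)
      (E := b'.re + r.re) ha' (by linarith)
      (by simp only [Complex.sub_re, Complex.add_re]; linarith)).mul_left (A * B)
    refine Summable.of_nonneg_of_le (fun i => integral_nonneg fun _ => norm_nonneg _)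
      (fun i => ?_) hmaj
    rw [hnorm i]
    refine (mul_le_mul (hcoef i) (hbeta (i.1 + i.2)) (norm_nonneg _) (by positivity)).trans
      (le_of_eq ?_)
    rw [neg_add, Real.rpow_add (by positivity)]
    ring
  have hlim : ∀ᵐ s ∂(volume.restrict (Set.Ioo (0 : ℝ) 1)),
      HasSum (fun i => F i s) (momentIntegrand a a' b b' c r s) := by
    filter_upwards [ae_restrict_mem measurableSet_Ioo] with s hs
    have hs1 : (0 : ℝ) < 1 - s := by linarith [hs.2]
    have hu : ‖(1 - s : ℂ)‖ < 1 := by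
      rw [← Complex.ofReal_one, ← Complex.ofReal_sub, Complex.norm_real,
        Real.norm_of_nonneg hs1.le]
      linarith [hs.1]
    have hne : (1 - s : ℂ) ≠ 0 := by
      rw [← Complex.ofReal_one, ← Complex.ofReal_sub]; exact_mod_cast hs1.ne'
    have := (summable_pfaff a a' b b' hc hu hu).hasSum.mul_left
      ((s : ℂ) ^ (r - 1) * (1 - (s : ℂ)) ^ (c - 1))
    refine this.congr_fun fun i => ?_
    simp only [hF]
    rw [show c + ((i.1 + i.2 : ℕ) : ℂ) - 1 = (c - 1) + ((i.1 + i.2 : ℕ) : ℂ) by ring,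
      Complex.cpow_add _ _ hne, Complex.cpow_natCast, pow_add]
    ring
  obtain ⟨hI, hS⟩ := integrable_and_hasSum_integral hint hsum hlim
  refine ⟨hI, ?_⟩
  have e : ∀ i, ∫ s in Set.Ioo (0 : ℝ) 1, F i s = pfaffCoeff a a' b b' c i *
      (Complex.Gamma r * Complex.Gamma (c + (i.1 + i.2 : ℕ)) *
        (Complex.Gamma (r + (c + (i.1 + i.2 : ℕ))))⁻¹) := by
    intro i
    simp only [hF]
    rw [integral_const_mul, integral_beta hr (hcN _)]
  simp only [e] at hS
  rw [← hS.tsum_eq]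
  exact tsum_pfaffCoeff_mul_beta hc h1 h2 hS.summable

/-- The recurrence of the moment values which mirrors `pfaffSeries_contiguous`. -/
theorem momentValue_contiguous {a a' b b' c r : ℂ} (hc : 0 < c.re) (hr : 0 < r.re) :
    momentValue a a' b b' c r = momentValue a (a' + 1) b b' c (r + 1) +
      b' / c * momentValue a (a' + 1) b (b' + 1) (c + 1) r := by
  have hc0 : c ≠ 0 := by rintro rfl; simp at hc
  have hr0 : r ≠ 0 := by rintro rfl; simp at hr
  simp only [momentValue]
  rw [Complex.one_div_Gamma_eq_self_mul_one_div_Gamma_add_one (r + b'), Complex.Gamma_add_one _ hc0,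
    Complex.Gamma_add_one _ hr0, show r + 1 + c - a - (a' + 1) - b = r + c - a - a' - b by ring,
    show r + 1 + b' - (a' + 1) = r + b' - a' by ring, show r + 1 + b' = r + b' + 1 by ring,
    show r + 1 + c - a - (a' + 1) = r + c - a - a' by ring,
    show r + 1 + c - (a' + 1) - b = r + c - a' - b by ring,
    show r + (c + 1) - a - (a' + 1) - b = r + c - a - a' - b by ring,
    show r + (b' + 1) - (a' + 1) = r + b' - a' by ring, show r + (b' + 1) = r + b' + 1 by ring,
    show r + (c + 1) - a - (a' + 1) = r + c - a - a' by ring,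
    show r + (c + 1) - (a' + 1) - b = r + c - a' - b by ring]
  have e : b' / c * (c * Complex.Gamma c) = b' * Complex.Gamma c := by field_simp
  linear_combination (-(Complex.Gamma r * Complex.Gamma (r + c - a - a' - b) *
    Complex.Gamma (r + b' - a') * ((Complex.Gamma (r + b' + 1))⁻¹ *
    (Complex.Gamma (r + c - a - a'))⁻¹ * (Complex.Gamma (r + c - a' - b))⁻¹))) * e

/-- The moments of the kernel, in the whole range of convergence. For `Re a' ≤ 0` the double series
need not be absolutely integrable; the contiguous relation reduces to large `Re a'`. -/
theorem moment {a a' b b' c r : ℂ} (hc : 0 < c.re) (hr : 0 < r.re)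
    (h1 : 0 < (r + b' - a').re) (h2 : 0 < (r + c - a - a' - b).re) :
    IntegrableOn (momentIntegrand a a' b b' c r) (Set.Ioo 0 1) ∧
      ∫ s in Set.Ioo (0 : ℝ) 1, momentIntegrand a a' b b' c r s = momentValue a a' b b' c r := by
  obtain ⟨k, hk⟩ := exists_nat_gt (-a'.re)
  induction k generalizing a' b' c r with
  | zero => exact moment_of_re_pos (by simpa using hk) hc hr h1 h2
  | succ k ih =>
    have hk' : -(a' + 1).re < k := by
      push_cast at hk; simp only [Complex.add_re, Complex.one_re]; linarith
    obtain ⟨i1, v1⟩ := ih (a' := a' + 1) (b' := b') (c := c) (r := r + 1) hc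
      (by simp only [Complex.add_re, Complex.one_re]; linarith)
      (by rwa [show r + 1 + b' - (a' + 1) = r + b' - a' by ring])
      (by rwa [show r + 1 + c - a - (a' + 1) - b = r + c - a - a' - b by ring]) hk'
    obtain ⟨i2, v2⟩ := ih (a' := a' + 1) (b' := b' + 1) (c := c + 1) (r := r)
      (by simp only [Complex.add_re, Complex.one_re]; linarith) hr
      (by rwa [show r + (b' + 1) - (a' + 1) = r + b' - a' by ring])
      (by rwa [show r + (c + 1) - a - (a' + 1) - b = r + c - a - a' - b by ring]) hk'
    have heq : Set.EqOn (fun s => momentIntegrand a (a' + 1) b b' c (r + 1) s +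
        b' / c * momentIntegrand a (a' + 1) b (b' + 1) (c + 1) r s)
        (momentIntegrand a a' b b' c r) (Set.Ioo 0 1) := by
      intro s hs
      have hs1 : (0 : ℝ) < 1 - s := by linarith [hs.2]
      have hu : ‖(1 - s : ℂ)‖ < 1 := by
        rw [← Complex.ofReal_one, ← Complex.ofReal_sub, Complex.norm_real,
          Real.norm_of_nonneg hs1.le]
        linarith [hs.1]
      have hne : (1 - s : ℂ) ≠ 0 := by
        rw [← Complex.ofReal_one, ← Complex.ofReal_sub]; exact_mod_cast hs1.ne'
      have hs0 : (s : ℂ) ≠ 0 := by exact_mod_cast hs.1.ne'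
      simp only [momentIntegrand]
      rw [pfaffSeries_contiguous a a' b b' hc hu, show r + 1 - 1 = (r - 1) + 1 by ring,
        Complex.cpow_add _ _ hs0, show c + 1 - 1 = (c - 1) + 1 by ring,
        Complex.cpow_add _ _ hne, Complex.cpow_one, Complex.cpow_one]
      ring
    have i2' := i2.const_mul (b' / c)
    refine ⟨(i1.add i2').congr_fun heq measurableSet_Ioo, ?_⟩
    rw [← setIntegral_congr_fun measurableSet_Ioo heq, integral_add i1 i2', integral_const_mul,
      v1, v2, ← momentValue_contiguous hc hr]

/-! ### Sine and hyperbolic sine -/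

/-- The entire function `∑ z^k / (2k+1)!`, for which `sin z = z S(-z²)` and `sinh z = z S(z²)`. -/
noncomputable def sineSeries (z : ℂ) : ℂ := ∑' k : ℕ, z ^ k / (2 * k + 1).factorial

theorem hasSum_sineSeries (z : ℂ) :
    HasSum (fun k : ℕ => z ^ k / (2 * k + 1).factorial) (sineSeries z) := by
  refine Summable.hasSum (Summable.of_norm_bounded (Real.summable_pow_div_factorial ‖z‖)
    fun k => ?_)
  rw [norm_div, norm_pow, Complex.norm_natCast]
  gcongr
  omega

theorem sin_eq_mul_sineSeries (z : ℂ) : Complex.sin z = z * sineSeries (-z ^ 2) := by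
  refine (Complex.hasSum_sin z).unique ?_
  refine ((hasSum_sineSeries (-z ^ 2)).mul_left z).congr_fun fun k => ?_
  rw [neg_pow (z ^ 2), ← pow_mul, pow_succ]
  ring

theorem sinh_eq_mul_sineSeries (z : ℂ) : Complex.sinh z = z * sineSeries (z ^ 2) := by
  refine (Complex.hasSum_sinh z).unique ?_
  refine ((hasSum_sineSeries (z ^ 2)).mul_left z).congr_fun fun k => ?_
  rw [← pow_mul, pow_succ]
  ring

/-- Termwise integration of the kernel against `s^(r-1) S(W s²)`. -/
theorem moment_sineSeries {a a' b b' c r : ℂ} (hc : 0 < c.re) (hr : 0 < r.re)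
    (h1 : 0 < (r + b' - a').re) (h2 : 0 < (r + c - a - a' - b).re) (W : ℂ) :
    IntegrableOn (fun s : ℝ => momentIntegrand a a' b b' c r s * sineSeries (W * s ^ 2))
        (Set.Ioo 0 1) ∧
      HasSum (fun k : ℕ => W ^ k / (2 * k + 1).factorial *
          momentValue a a' b b' c (r + ((2 : ℝ) : ℂ) * k))
        (∫ s in Set.Ioo (0 : ℝ) 1, momentIntegrand a a' b b' c r s * sineSeries (W * s ^ 2)) := by
  have hre : ∀ (z : ℂ) (k : ℕ), 0 < z.re → 0 < (z + ((2 : ℝ) : ℂ) * k).re := by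
    intro z k hz
    simp
    positivity
  have hmom : ∀ k : ℕ, _ := fun k => moment (a := a) (a' := a') (b := b) (b' := b') hc (hre r k hr)
    (by rw [show r + ((2 : ℝ) : ℂ) * k + b' - a' = r + b' - a' + ((2 : ℝ) : ℂ) * k by ring]
        exact hre _ k h1)
    (by rw [show r + ((2 : ℝ) : ℂ) * k + c - a - a' - b =
          r + c - a - a' - b + ((2 : ℝ) : ℂ) * k by ring]
        exact hre _ k h2)
  have hshift : ∀ k : ℕ, Set.EqOn (momentIntegrand a a' b b' c (r + ((2 : ℝ) : ℂ) * k))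
      (fun s => momentIntegrand a a' b b' c r s * (s : ℂ) ^ (2 * k)) (Set.Ioo 0 1) := by
    intro k s hs
    have hs0 : (s : ℂ) ≠ 0 := by exact_mod_cast hs.1.ne'
    simp only [momentIntegrand]
    rw [show r + ((2 : ℝ) : ℂ) * k - 1 = r - 1 + ((2 * k : ℕ) : ℂ) by push_cast; ring,
      Complex.cpow_add _ _ hs0, Complex.cpow_natCast]
    ring
  set F : ℕ → ℝ → ℂ := fun k s => W ^ k / (2 * k + 1).factorial *
    (momentIntegrand a a' b b' c r s * (s : ℂ) ^ (2 * k)) with hF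
  have hFint : ∀ k, IntegrableOn (F k) (Set.Ioo 0 1) := fun k =>
    ((hmom k).1.congr_fun (hshift k) measurableSet_Ioo).const_mul _
  have hval : ∀ k, ∫ s in Set.Ioo (0 : ℝ) 1, F k s = W ^ k / (2 * k + 1).factorial *
      momentValue a a' b b' c (r + ((2 : ℝ) : ℂ) * k) := by
    intro k
    simp only [hF]
    rw [integral_const_mul, ← setIntegral_congr_fun measurableSet_Ioo (hshift k), (hmom k).2]
  have hbase := (moment (a := a) (a' := a') (b := b) (b' := b') hc hr h1 h2).1
  have hsum : Summable fun k => ∫ s in Set.Ioo (0 : ℝ) 1, ‖F k s‖ := by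
    refine Summable.of_nonneg_of_le (fun k => integral_nonneg fun _ => norm_nonneg _) (fun k => ?_)
      ((hasSum_sineSeries W).summable.norm.mul_right
        (∫ s in Set.Ioo (0 : ℝ) 1, ‖momentIntegrand a a' b b' c r s‖))
    rw [← integral_const_mul]
    refine setIntegral_mono_on (hFint k).norm (hbase.norm.const_mul _) measurableSet_Ioo
      fun s hs => ?_
    simp only [hF]
    rw [norm_mul]
    refine mul_le_mul_of_nonneg_left ?_ (norm_nonneg _)
    rw [norm_mul, norm_pow, Complex.norm_real, Real.norm_of_nonneg hs.1.le]
    exact mul_le_of_le_one_right (norm_nonneg _) (pow_le_one₀ hs.1.le hs.2.le)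
  have hlim : ∀ᵐ s ∂(volume.restrict (Set.Ioo (0 : ℝ) 1)), HasSum (fun k => F k s)
      (momentIntegrand a a' b b' c r s * sineSeries (W * s ^ 2)) := by
    refine Eventually.of_forall fun s => ?_
    refine ((hasSum_sineSeries (W * s ^ 2)).mul_left
      (momentIntegrand a a' b b' c r s)).congr_fun fun k => ?_
    simp only [hF]
    rw [mul_pow, ← pow_mul]
    ring
  obtain ⟨hI, hS⟩ := integrable_and_hasSum_integral hFint hsum hlim
  exact ⟨hI, hS.congr_fun fun k => (hval k).symm⟩

/-- The duplication formula for `(2k + 1)!`. -/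
theorem Gamma_three_halves_add_natCast (k : ℕ) :
    Complex.Gamma (3 / 2 + k) * k.factorial * 4 ^ k * 2 =
      (Real.sqrt Real.pi : ℂ) * (2 * k + 1).factorial := by
  induction k with
  | zero =>
    have h : Complex.Gamma (1 / 2) = (Real.sqrt Real.pi : ℂ) := by
      rw [← Real.Gamma_one_half_eq, ← Complex.Gamma_ofReal]; norm_num
    rw [show (3 / 2 + ((0 : ℕ) : ℂ)) = 1 / 2 + 1 by norm_num,
      Complex.Gamma_add_one _ (by norm_num), h]
    simp
    ring
  | succ k ih =>
    have hne : (3 / 2 : ℂ) + k ≠ 0 := add_natCast_ne_zero_of_re_pos (by norm_num) k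
    rw [show (3 / 2 + ((k + 1 : ℕ) : ℂ)) = 3 / 2 + k + 1 by push_cast; ring,
      Complex.Gamma_add_one _ hne, show 2 * (k + 1) + 1 = 2 * k + 1 + 1 + 1 by ring,
      Nat.factorial_succ, Nat.factorial_succ, Nat.factorial_succ, pow_succ]
    push_cast
    linear_combination (3 / 2 + (k : ℂ)) * (k + 1) * 4 * ih

/-- The moments of the kernel are, up to constants, the terms of the Wright series. -/
theorem momentValue_eq_wrightTerm (α α' β β' γ r W : ℂ) (k : ℕ) :
    W ^ k / (2 * k + 1).factorial * momentValue α α' β β' γ (r + ((2 : ℝ) : ℂ) * k) =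
      Complex.Gamma γ * ((Real.sqrt Real.pi : ℂ) / 2) *
        wrightTerm (upperParams α α' β β' γ r) (lowerParams α α' β β' γ r) (W / 4) k := by
  have hG : Complex.Gamma (3 / 2 + k) ≠ 0 :=
    Complex.Gamma_ne_zero_of_re_pos (by simp; positivity)
  have hk : (k.factorial : ℂ) ≠ 0 := by exact_mod_cast Nat.factorial_ne_zero k
  have hk2 : ((2 * k + 1).factorial : ℂ) ≠ 0 := by exact_mod_cast Nat.factorial_ne_zero (2 * k + 1)
  have h4 : (4 : ℂ) ^ k ≠ 0 := pow_ne_zero k (by norm_num)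
  have hdup : (1 : ℂ) / (2 * k + 1).factorial = (Real.sqrt Real.pi : ℂ) / 2 *
      ((Complex.Gamma (3 / 2 + k))⁻¹ / (4 ^ k * k.factorial)) := by
    have := Gamma_three_halves_add_natCast k
    generalize Complex.Gamma (3 / 2 + k) = g at hG this ⊢
    field_simp
    linear_combination this
  simp only [wrightTerm, upperParams, lowerParams, Fin.prod_univ_three, Fin.prod_univ_four,
    momentValue, Matrix.cons_val]
  simp only [Complex.ofReal_one, one_mul]
  have e : ∀ z : ℂ, r + ((2 : ℝ) : ℂ) * k + z = r + z + ((2 : ℝ) : ℂ) * k := fun z => by ring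
  have e' : ∀ y z : ℂ, y + ((2 : ℝ) : ℂ) * k - z = y - z + ((2 : ℝ) : ℂ) * k := fun y z => by ring
  simp only [e, e']
  rw [div_eq_mul_one_div (W ^ k), hdup, div_pow]
  simp only [div_eq_mul_inv, mul_inv]
  ring_nf

/-- The kernel in the variable `s = t / x`. -/
theorem msmIntegrand_mul_eq {α α' β β' γ : ℂ} (hγ : 0 < γ.re) (ρ c : ℂ) (f : ℝ → ℂ) (W : ℂ)
    {x : ℝ} (hx : 0 < x)
    (hf : ∀ s : ℝ, f (x * s) = ((x * s : ℝ) : ℂ) ^ (ρ - 1) *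
      (c * ((x * s : ℝ) : ℂ) * sineSeries (W * s ^ 2))) {s : ℝ} (hs : s ∈ Set.Ioo (0 : ℝ) 1) :
    msmIntegrand α α' β β' γ f x (x * s) =
      c * (x : ℂ) ^ (ρ - α' + γ - 1) *
        (momentIntegrand α α' β β' γ (ρ + 1) s * sineSeries (W * s ^ 2)) := by
  have hs1 : (0 : ℝ) < 1 - s := by linarith [hs.2]
  have hxc : (x : ℂ) ≠ 0 := by exact_mod_cast hx.ne'
  have hsc : (s : ℂ) ≠ 0 := by exact_mod_cast hs.1.ne'
  have e1 : x - x * s = x * (1 - s) := by ring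
  have e2 : 1 - x * s / x = 1 - s := by field_simp
  have e3 : 1 - x / (x * s) = 1 - s⁻¹ := by
    have := hs.1.ne'
    field_simp
  have hcan : (s : ℂ) ^ (-α') * (s : ℂ) ^ α' = 1 := by
    rw [← Complex.cpow_add _ _ hsc]; simp
  rw [msmIntegrand, hf, e1, e2, e3, appellF3_eq_cpow_mul_pfaffSeries α α' β β' hγ hs.1 hs.2,
    momentIntegrand, Complex.ofReal_mul, Complex.ofReal_mul,
    Complex.mul_cpow_ofReal_nonneg hx.le hs1.le, Complex.mul_cpow_ofReal_nonneg hx.le hs.1.le,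
    Complex.mul_cpow_ofReal_nonneg hx.le hs.1.le, show ρ + 1 - 1 = (ρ - 1) + 1 by ring,
    Complex.cpow_add _ _ hsc, Complex.cpow_one,
    show ρ - α' + γ - 1 = (γ - 1) + -α' + (ρ - 1) + 1 by ring, Complex.cpow_add _ _ hxc,
    Complex.cpow_add _ _ hxc, Complex.cpow_add _ _ hxc, Complex.cpow_one]
  push_cast
  linear_combination ((x : ℂ) ^ (γ - 1) * (x : ℂ) ^ (-α') * (x : ℂ) ^ (ρ - 1) * x * c *
    ((s : ℂ) ^ (ρ - 1) * s * (1 - (s : ℂ)) ^ (γ - 1) * pfaffSeries α α' β β' γ (1 - s) *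
      sineSeries (W * s ^ 2))) * hcan

/-- The common form of both formulas, for a function equal to `c t^ρ S(W (t / x)²)`. -/
theorem msmLeft_sineSeries {α α' β β' γ ρ : ℂ} (c : ℂ) (hγ : 0 < γ.re)
    (hρ : max 0 (max (α + α' + β - γ).re (α' - β').re) < (ρ + 1).re) (f : ℝ → ℂ) (W : ℂ)
    {x : ℝ} (hx : 0 < x)
    (hf : ∀ s : ℝ, f (x * s) = ((x * s : ℝ) : ℂ) ^ (ρ - 1) *
      (c * ((x * s : ℝ) : ℂ) * sineSeries (W * s ^ 2))) :
    IntegrableOn (msmIntegrand α α' β β' γ f x) (Set.Ioo 0 x) ∧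
      Summable (wrightTerm (upperParams α α' β β' γ (ρ + 1)) (lowerParams α α' β β' γ (ρ + 1))
        (W / 4)) ∧
      msmLeft α α' β β' γ f x = c / 2 * (Real.sqrt Real.pi : ℂ) * (x : ℂ) ^ (ρ - α - α' + γ) *
        wrightPsi (upperParams α α' β β' γ (ρ + 1)) (lowerParams α α' β β' γ (ρ + 1)) (W / 4) := by
  simp only [max_lt_iff] at hρ
  obtain ⟨hr, h2, h1⟩ := hρ
  have hG : Complex.Gamma γ ≠ 0 := Complex.Gamma_ne_zero_of_re_pos hγ
  have hpi : (Real.sqrt Real.pi : ℂ) ≠ 0 := by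
    exact_mod_cast (Real.sqrt_pos.2 Real.pi_pos).ne'
  have hxc : (x : ℂ) ≠ 0 := by exact_mod_cast hx.ne'
  obtain ⟨hI, hS⟩ := moment_sineSeries (a := α) (a' := α') (b := β) (b' := β') (r := ρ + 1) hγ hr
    (by simp only [Complex.add_re, Complex.sub_re] at h1 ⊢; linarith)
    (by simp only [Complex.add_re, Complex.sub_re] at h2 ⊢; linarith) W
  simp only [momentValue_eq_wrightTerm] at hS
  have heq : Set.EqOn (fun s => c * (x : ℂ) ^ (ρ - α' + γ - 1) *
      (momentIntegrand α α' β β' γ (ρ + 1) s * sineSeries (W * s ^ 2)))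
      (fun s => msmIntegrand α α' β β' γ f x (x * s)) (Set.Ioo 0 1) :=
    fun s hs => (msmIntegrand_mul_eq hγ ρ c f W hx hf hs).symm
  have hsumm : Summable (wrightTerm (upperParams α α' β β' γ (ρ + 1))
      (lowerParams α α' β β' γ (ρ + 1)) (W / 4)) :=
    (summable_mul_left_iff (mul_ne_zero hG (div_ne_zero hpi two_ne_zero))).1 hS.summable
  refine ⟨?_, hsumm, ?_⟩
  · have h := IntegrableOn.congr_fun (hI.const_mul (c * (x : ℂ) ^ (ρ - α' + γ - 1))) heq
      measurableSet_Ioo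
    have h' := (intervalIntegrable_iff_integrableOn_Ioo_of_le zero_le_one).2 h
    have h'' := h'.comp_mul_left (c := x⁻¹)
    simp only [mul_inv_cancel_left₀ hx.ne', div_inv_eq_mul, zero_mul, one_mul] at h''
    exact (intervalIntegrable_iff_integrableOn_Ioo_of_le hx.le).1 h''
  · have hchange : ∫ t in Set.Ioo 0 x, msmIntegrand α α' β β' γ f x t =
        x * ∫ s in Set.Ioo (0 : ℝ) 1, msmIntegrand α α' β β' γ f x (x * s) := by
      rw [← integral_Ioc_eq_integral_Ioo, ← integral_Ioc_eq_integral_Ioo,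
        ← intervalIntegral.integral_of_le hx.le, ← intervalIntegral.integral_of_le zero_le_one,
        intervalIntegral.integral_comp_mul_left _ hx.ne', mul_zero, mul_one, Complex.real_smul,
        Complex.ofReal_inv, mul_inv_cancel_left₀ hxc]
    rw [msmLeft, hchange, ← setIntegral_congr_fun measurableSet_Ioo heq, integral_const_mul,
      ← hS.tsum_eq, tsum_mul_left, wrightPsi,
      show ρ - α - α' + γ = -α + 1 + (ρ - α' + γ - 1) by ring, Complex.cpow_add _ _ hxc,
      Complex.cpow_add _ _ hxc, Complex.cpow_one]
    field_simp

theorem mainTheorem9 (α α' β β' γ ρ c : ℂ) (hγ : 0 < γ.re)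
    (hρ : max 0 (max (α + α' + β - γ).re (α' - β').re) < (ρ + 1).re)
    (x : ℝ) (hx : 0 < x) :
    (IntegrableOn
        (msmIntegrand α α' β β' γ (fun t : ℝ => (t : ℂ) ^ (ρ - 1) * Complex.sin (c * t)) x)
        (Set.Ioo 0 x) ∧
      Summable (wrightTerm (upperParams α α' β β' γ (ρ + 1)) (lowerParams α α' β β' γ (ρ + 1))
        (-(c ^ 2 * (x : ℂ) ^ 2 / 4))) ∧
      msmLeft α α' β β' γ (fun t : ℝ => (t : ℂ) ^ (ρ - 1) * Complex.sin (c * t)) x =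
        c / 2 * (Real.sqrt Real.pi : ℂ) * (x : ℂ) ^ (ρ - α - α' + γ) *
          wrightPsi (upperParams α α' β β' γ (ρ + 1)) (lowerParams α α' β β' γ (ρ + 1))
            (-(c ^ 2 * (x : ℂ) ^ 2 / 4))) ∧
    (IntegrableOn
        (msmIntegrand α α' β β' γ (fun t : ℝ => (t : ℂ) ^ (ρ - 1) * Complex.sinh (c * t)) x)
        (Set.Ioo 0 x) ∧
      Summable (wrightTerm (upperParams α α' β β' γ (ρ + 1)) (lowerParams α α' β β' γ (ρ + 1))
        (c ^ 2 * (x : ℂ) ^ 2 / 4)) ∧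
      msmLeft α α' β β' γ (fun t : ℝ => (t : ℂ) ^ (ρ - 1) * Complex.sinh (c * t)) x =
        c / 2 * (Real.sqrt Real.pi : ℂ) * (x : ℂ) ^ (ρ - α - α' + γ) *
          wrightPsi (upperParams α α' β β' γ (ρ + 1)) (lowerParams α α' β β' γ (ρ + 1))
            (c ^ 2 * (x : ℂ) ^ 2 / 4)) := by

  refine ⟨?_, ?_⟩
  · rw [show -(c ^ 2 * (x : ℂ) ^ 2 / 4) = -(c ^ 2 * (x : ℂ) ^ 2) / 4 by ring]
    refine msmLeft_sineSeries c hγ hρ _ _ hx fun s => ?_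
    rw [sin_eq_mul_sineSeries]
    push_cast
    ring_nf
  · refine msmLeft_sineSeries c hγ hρ _ _ hx fun s => ?_
    rw [sinh_eq_mul_sineSeries]
    push_cast
    ring_nf
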